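/- For a topological space $X$ and a homeomorphism $g$ of $X$ let $\operatorname{supp}^e g=\operatorname{int}\,\overline{\{x\in X: g(x)\neq x\}}$ be its extended support; a set $W\subseteq X$ is regular open if $W=\operatorname{int}\overline{W}$. There is a first-order formula $\mathrm{infcomp}(w)$ in the language of groups (multiplication, inverse, identity), with one free variable $w$ and without parameters, such that the following holds for every closed (compact, without boundary), connected, smooth manifold $M$ of dimension $n\ge 1$ and every group $G$ of homeomorphisms of $M$ satisfying one of (a) $\mathrm{Diff}^\infty_0(M)\le G\le \mathrm{Homeo}(M)$, or (b) $n\ge 2$ and $\mathrm{Diff}^\infty_{0,\omega}(M)\le G\le \mathrm{Homeo}_\omega(M)$ for some smooth volume $\omega$ on $M$ (a measure with a smooth, everywhere positive density in local coordinates, such as the one given by a smooth volume form). Here $\mathrm{Diff}^\infty_0(M)$ is the identity component of the group of smooth diffeomorphisms of $M$, i.e. the group of diffeomorphisms smoothly isotopic to the identity, $\mathrm{Homeo}_\omega(M)$ is the group of $\omega$-preserving homeomorphisms, and $\mathrm{Diff}^\infty_{0,\omega}(M)$ is the identity component of the group of $\omega$-preserving smooth diffeomorphisms, i.e. the group of those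 smoothly isotopic to the identity through $\omega$-preserving diffeomorphisms. (In particular, $G$ may be the full or the $\omega$-preserving group of $C^r$ diffeomorphisms for any $r\in\{0\}\cup[1,\infty]$.) Every regular open set $W\subseteq M$ is of the form $W=\operatorname{supp}^e g$ for some $g\in G$, and for every such $g$, $$G\models \mathrm{infcomp}(g)\iff W \text{ has infinitely many connected components.}$$ Thus $\mathrm{infcomp}$ holds for a regular open set $W$ precisely when $W$ has infinitely many connected components, uniformly in $M$ and $G$. -/

import Mathlib

open scoped Manifold ContDiff
open MeasureTheory

namespace DiffGroups

/-! ### The first-order language of groups -/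

/-- Function symbols of the language of groups: multiplication, inverse, identity. -/
inductive GroupFunc : ℕ → Type
  | mul : GroupFunc 2
  | inv : GroupFunc 1
  | one : GroupFunc 0

/-- The language of groups; equality is the only relation. -/
def groupLang : FirstOrder.Language where
  Functions := GroupFunc
  Relations := fun _ => Empty

/-- Every group is a structure for the language of groups in the usual way. -/
instance groupStructure (G : Type*) [Group G] : groupLang.Structure G where
  funMap {_} f x :=
    match f, x with
    | GroupFunc.mul, x => x 0 * x 1
    | GroupFunc.inv, x => (x 0)⁻¹
    | GroupFunc.one, _ => 1
  RelMap {_} r _ := nomatch r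

/-! ### Regular open sets and extended supports -/

/-- `W` is regular open: it equals the interior of its closure. -/
def IsRegularOpen {X : Type*} [TopologicalSpace X] (W : Set X) : Prop :=
  interior (closure W) = W

/-- The extended support of `g`: the interior of the closure of `X \ Fix g`. -/
def extSupport {X : Type*} [TopologicalSpace X] (g : X ≃ₜ X) : Set X :=
  interior (closure {x | g x ≠ x})

/-! ### Diffeomorphism groups of smooth `n`-manifolds without boundary

All groups are regarded inside the group `M ≃ₜ M` of self-homeomorphisms of `M`. -/

section Manifold

variable (n : ℕ) {M : Type*} [TopologicalSpace M] [ChartedSpace (EuclideanSpace ℝ (Fin n)) M]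

/-- The homeomorphism `f` is a smooth diffeomorphism. -/
def IsSmoothDiffeo (f : M ≃ₜ M) : Prop :=
  ContMDiff (𝓡 n) (𝓡 n) ∞ f ∧ ContMDiff (𝓡 n) (𝓡 n) ∞ f.symm

/-- `F` is a smooth isotopy of `M` that starts at the identity: a family `F t` of smooth
diffeomorphisms, jointly smooth in `(t, x)`, with `F 0 = id`. (A smooth isotopy over `[0, 1]`
can be reparametrized to be constant near the end points, hence to be defined over `ℝ`.) -/
def IsSmoothIsotopy (F : ℝ → (M ≃ₜ M)) : Prop :=
  F 0 = 1 ∧ (∀ t, IsSmoothDiffeo n (F t)) ∧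
    ContMDiff (𝓘(ℝ, ℝ).prod (𝓡 n)) (𝓡 n) ∞ (fun p : ℝ × M => F p.1 p.2)

variable (M) in
/-- `Diff₀^∞(M)`: the smooth diffeomorphisms that are smoothly isotopic to the identity.
For compact `M` this is the identity component of the group of smooth diffeomorphisms with
its `C^∞` topology. -/
def diffZero : Set (M ≃ₜ M) :=
  {f | ∃ F : ℝ → (M ≃ₜ M), IsSmoothIsotopy n F ∧ F 1 = f}

variable [MeasurableSpace M]

/-- `μ` is a smooth volume on `M`: in the charts of `M` it has a smooth, everywhere positive
density with respect to Lebesgue measure. The measure of a smooth volume form `ω`, which in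
local coordinates is `|ω(∂₁, …, ∂ₙ)| dx`, is of this kind. -/
def IsSmoothVolume (μ : Measure M) : Prop :=
  ∀ p : M, ∃ ρ : EuclideanSpace ℝ (Fin n) → ℝ,
    ContDiffOn ℝ ∞ ρ (chartAt (EuclideanSpace ℝ (Fin n)) p).target ∧
    (∀ z ∈ (chartAt (EuclideanSpace ℝ (Fin n)) p).target, 0 < ρ z) ∧
    ∀ A : Set M, MeasurableSet A → A ⊆ (chartAt (EuclideanSpace ℝ (Fin n)) p).source →
      μ A = ∫⁻ z in chartAt (EuclideanSpace ℝ (Fin n)) p '' A, ENNReal.ofReal (ρ z)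

/-- `Diff₀,ω^∞(M)`: the diffeomorphisms that are smoothly isotopic to the identity through
volume-preserving diffeomorphisms. For compact `M` this is the identity component of the group
of volume-preserving smooth diffeomorphisms. -/
def diffZeroVol (μ : Measure M) : Set (M ≃ₜ M) :=
  {f | ∃ F : ℝ → (M ≃ₜ M),
    IsSmoothIsotopy n F ∧ (∀ t, MeasurePreserving (F t) μ μ) ∧ F 1 = f}

/-- The groups `G` under consideration: either `Diff₀^∞(M) ≤ G ≤ Homeo(M)`, or `n ≥ 2` and
`Diff₀,ω^∞(M) ≤ G ≤ Homeo_ω(M)` for some smooth volume `ω` on `M`. -/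
def IsAdmissible (G : Subgroup (M ≃ₜ M)) : Prop :=
  diffZero n M ⊆ G ∨
    (2 ≤ n ∧ ∃ μ : Measure M, IsSmoothVolume n μ ∧ diffZeroVol n μ ⊆ G ∧
      ∀ g ∈ G, MeasurePreserving g μ μ)

end Manifold

end DiffGroups

/-!
The formula expresses, inside the group `G`, enough of the topology of the extended supports of its
elements; the diffeomorphisms supported in small balls show that it expresses what it should.

*Supports.* Call `g` and `k` algebraically disjoint if every `h` that does not commute with `g`
has a nontrivial commutator `⁅f₁, ⁅f₂, h⁆⁆` that commutes with `k`, for some `f₁`, `f₂` in the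
centralizer of `k`. In a locally moving group of homeomorphisms of a Hausdorff space, disjointness
of the supports of `g` and `k` implies this (`algDisjoint_of_forall_fixed`), and this implies that
the supports of `g` and `k ^ 12` are disjoint (`pow_smul_eq_of_algDisjoint`). As every nonempty open
set supports an element with `k ^ 12 ≠ 1`, inclusion of extended supports is first-order
(`suppLE_iff`).

*Components.* If every regular open set is an extended support and `G` can move points a little by
elements with small support, then the extended support of `c` is connected exactly if no proper
regular open piece of it is a block for the elements supported in it (`connSupp_iff`). Hence the
connected components of an extended support are first-order (`compSupp_iff`), as extended supports
of elements again.

*Infinity.* A regular open set `W` has infinitely many components if and only if there are regular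
open sets `U`, `R`, `S` such that the components of `R` match the components of `W` that meet `U`
perfectly in pairs, whereas those of `S` match all but one of them (`HasMatchings`); here a
component of `R` or `S` joins two components of `W` if it meets both of them inside `U`. For
finitely many components this is impossible by parity (`HasMatchings.infinite`). If there are
infinitely many, then they accumulate at a point `p`, and in a chart around `p` there are points
`a k` of different components at which a linear coordinate takes quickly decreasing values. A slab
around each interval between the values at `a k` and `a (k + 1)` joins these two components; the
slabs with even `k` form `R`, and the ones with odd `k` form `S` (`exists_hasMatchings`).

*Flexibility.* It remains to construct enough elements of `G`, which can be done in `ℝⁿ`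
(`ContainsChartIsotopies.locallyDense`, `ContainsChartIsotopies.locallyMixing`): isotopies that move
a dense set of points of a given bounded open set and fix everything off it, and isotopies with
small support from a point to a nearby one. Without a volume, pushes in a fixed direction do
(`exists_push`). With a volume, there are charts in which it is Lebesgue measure
(`IsSmoothVolume.exists_isVolumeChart`), and in these charts the rotations of disjoint balls, with
an angle that depends on the distance to the centre, preserve it (`measurePreserving_swirl`); almost
all of an open set can be covered by such balls.
-/

namespace DiffGroups

/-! ### First-order predicates on groups -/

section Semantic

open scoped commutatorElement

variable {G : Type*} [Group G]

/-- Rubin's algebraic disjointness. If the supports of `g` and `k` are disjoint then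
`AlgDisjoint g k` holds, and `AlgDisjoint g k` forces the supports of `g` and `k ^ 12` to be
disjoint. -/
def AlgDisjoint (g k : G) : Prop :=
  ∀ h, ¬ Commute g h → ∃ f₁ f₂, Commute f₁ k ∧ Commute f₂ k ∧
    ⁅f₁, ⁅f₂, h⁆⁆ ≠ 1 ∧ Commute ⁅f₁, ⁅f₂, h⁆⁆ k

/-- The group-theoretic form of `supp^e f ⊆ supp^e g`. -/
def SuppLE (f g : G) : Prop :=
  ∀ k, AlgDisjoint g k → Commute f (k ^ 12)

/-- The group-theoretic form of: the three extended supports have a common point. -/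
def Meet (a b c : G) : Prop :=
  ∃ k, k ≠ 1 ∧ SuppLE k a ∧ SuppLE k b ∧ SuppLE k c

/-- The group-theoretic form of: the extended support of `c` is connected. It says that no proper
piece `d` of `c` is a block for the elements supported in `c`. -/
def ConnSupp (c : G) : Prop :=
  c ≠ 1 ∧ ∀ d, d ≠ 1 → SuppLE d c →
    (∀ g, SuppLE g c → Meet (g * d * g⁻¹) d d → SuppLE (g * d * g⁻¹) d) → SuppLE c d

/-- The group-theoretic form of: the extended support of `c` is a connected component of that
of `w`. -/
def CompSupp (c w : G) : Prop :=
  ConnSupp c ∧ SuppLE c w ∧ ∀ d, ConnSupp d → SuppLE d w → SuppLE c d → SuppLE d c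

/-- `a` represents a component of `w` that meets the marker set `u`. -/
def Node (w u a : G) : Prop :=
  CompSupp a w ∧ Meet a u u

/-- The components `a` and `b` are different and some component of `r` meets the marked parts of
both. -/
def Adj (u r a b : G) : Prop :=
  ¬ SuppLE a b ∧ ∃ ρ, CompSupp ρ r ∧ Meet ρ a u ∧ Meet ρ b u

/-- The node `a` has exactly one neighbour. -/
def UniqueAdj (w u r a : G) : Prop :=
  ∃ b, Node w u b ∧ Adj u r a b ∧ ∀ c, Node w u c → Adj u r a c → SuppLE b c

/-- `w` has infinitely many components: some set of components carries two matchings, of which one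
is perfect and the other one misses exactly one component. -/
def InfComp (w : G) : Prop :=
  ∃ u r s, (∀ a, Node w u a → UniqueAdj w u r a) ∧
    ∃ o, Node w u o ∧ (∀ b, Node w u b → ¬ Adj u s o b) ∧
      ∀ a, Node w u a → ¬ SuppLE a o → UniqueAdj w u s a

end Semantic

/-! ### Formulas for these predicates -/

section Syntactic

open FirstOrder FirstOrder.Language
open scoped commutatorElement

variable {α : Type} {G : Type*} [Group G]

/-- The multiplication symbol. -/
def mulSymb : groupLang.Functions 2 := GroupFunc.mul

/-- The inversion symbol. -/
def invSymb : groupLang.Functions 1 := GroupFunc.inv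

/-- The identity symbol. -/
def oneSymb : groupLang.Constants := GroupFunc.one

/-- Product of terms. -/
def mulT (s t : groupLang.Term α) : groupLang.Term α :=
  mulSymb.apply₂ s t

/-- Inverse of a term. -/
def invT (s : groupLang.Term α) : groupLang.Term α :=
  invSymb.apply₁ s

/-- The identity as a term. -/
def oneT : groupLang.Term α :=
  oneSymb.term

/-- Powers of a term. -/
def powT (s : groupLang.Term α) : ℕ → groupLang.Term α
  | 0 => oneT
  | n + 1 => mulT (powT s n) s

/-- The commutator of two terms. -/
def commT (s t : groupLang.Term α) : groupLang.Term α :=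
  mulT (mulT (mulT s t) (invT s)) (invT t)

@[simp] theorem realize_mulT (s t : groupLang.Term α) (v : α → G) :
    (mulT s t).realize v = s.realize v * t.realize v := by
  rw [mulT, Term.realize_functions_apply₂]; rfl

@[simp] theorem realize_invT (s : groupLang.Term α) (v : α → G) :
    (invT s).realize v = (s.realize v)⁻¹ := by
  rw [invT, Term.realize_functions_apply₁]; rfl

@[simp] theorem realize_oneT (v : α → G) : (oneT : groupLang.Term α).realize v = 1 := by
  rw [oneT, Term.realize_constants]; rfl

@[simp] theorem realize_powT (s : groupLang.Term α) (n : ℕ) (v : α → G) :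
    (powT s n).realize v = s.realize v ^ n := by
  induction n with
  | zero => simp [powT]
  | succ n ih => simp [powT, ih, pow_succ]

@[simp] theorem realize_commT (s t : groupLang.Term α) (v : α → G) :
    (commT s t).realize v = ⁅s.realize v, t.realize v⁆ := by
  simp [commT, commutatorElement_def]

/-- The newest variable, bound by the innermost quantifier. -/
def newT : groupLang.Term (Option α) := Term.var none

/-- Weakening of a term under a quantifier. -/
def upT (s : groupLang.Term α) : groupLang.Term (Option α) := s.relabel some

@[simp] theorem realize_newT (v : α → G) (x : G) :
    (newT : groupLang.Term (Option α)).realize (fun o => o.elim x v) = x := rfl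

@[simp] theorem realize_upT (s : groupLang.Term α) (v : α → G) (x : G) :
    (upT s).realize (fun o => o.elim x v) = s.realize v := by
  rw [upT, Term.realize_relabel]; rfl

/-- Universal quantification over the variable `none`. -/
def allF (φ : groupLang.Formula (Option α)) : groupLang.Formula α :=
  (BoundedFormula.relabel (n := 1) (k := 0)
    (fun o : Option α => o.elim (Sum.inr 0) Sum.inl) φ).all

@[simp] theorem realize_allF (φ : groupLang.Formula (Option α)) (v : α → G) :
    (allF φ).Realize v ↔ ∀ x : G, φ.Realize (fun o => o.elim x v) := by
  rw [allF, Formula.Realize, BoundedFormula.realize_all]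
  refine forall_congr' fun x => ?_
  rw [BoundedFormula.realize_relabel, Formula.Realize]
  refine iff_of_eq (congrArg₂ _ (funext fun o => ?_) (Subsingleton.elim _ _))
  cases o <;> rfl

/-- Existential quantification over the variable `none`. -/
def exF (φ : groupLang.Formula (Option α)) : groupLang.Formula α := (allF φ.not).not

@[simp] theorem realize_exF (φ : groupLang.Formula (Option α)) (v : α → G) :
    (exF φ).Realize v ↔ ∃ x : G, φ.Realize (fun o => o.elim x v) := by
  simp [exF, Formula.realize_not]

/-- Equality of terms. -/
def eqF (s t : groupLang.Term α) : groupLang.Formula α := s.equal t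

@[simp] theorem realize_eqF (s t : groupLang.Term α) (v : α → G) :
    (eqF s t).Realize v ↔ s.realize v = t.realize v := by
  simp [eqF, Formula.realize_equal]

/-- The formula for `Commute`. -/
def commuteF (s t : groupLang.Term α) : groupLang.Formula α := eqF (mulT s t) (mulT t s)

@[simp] theorem realize_commuteF (s t : groupLang.Term α) (v : α → G) :
    (commuteF s t).Realize v ↔ Commute (s.realize v) (t.realize v) := by
  simp [commuteF, Commute, SemiconjBy]

/-- The formula for `AlgDisjoint`. -/
def algDisjointF (g k : groupLang.Term α) : groupLang.Formula α :=
  allF ((commuteF (upT g) newT).not.imp (exF (exF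
    (commuteF (upT newT) (upT (upT (upT k))) ⊓
    (commuteF newT (upT (upT (upT k))) ⊓
    ((eqF (commT (upT newT) (commT newT (upT (upT newT)))) oneT).not ⊓
      commuteF (commT (upT newT) (commT newT (upT (upT newT)))) (upT (upT (upT k)))))))))

@[simp] theorem realize_algDisjointF (g k : groupLang.Term α) (v : α → G) :
    (algDisjointF g k).Realize v ↔ AlgDisjoint (g.realize v) (k.realize v) := by
  simp [algDisjointF, AlgDisjoint, Formula.realize_imp, Formula.realize_not, Formula.realize_inf]

/-- The formula for `SuppLE`. -/
def suppLEF (f g : groupLang.Term α) : groupLang.Formula α :=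
  allF ((algDisjointF (upT g) newT).imp (commuteF (upT f) (powT newT 12)))

@[simp] theorem realize_suppLEF (f g : groupLang.Term α) (v : α → G) :
    (suppLEF f g).Realize v ↔ SuppLE (f.realize v) (g.realize v) := by
  simp [suppLEF, SuppLE, Formula.realize_imp]

/-- The formula for `Meet`. -/
def meetF (a b c : groupLang.Term α) : groupLang.Formula α :=
  exF ((eqF newT oneT).not ⊓ (suppLEF newT (upT a) ⊓ (suppLEF newT (upT b) ⊓
    suppLEF newT (upT c))))

@[simp] theorem realize_meetF (a b c : groupLang.Term α) (v : α → G) :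
    (meetF a b c).Realize v ↔ Meet (a.realize v) (b.realize v) (c.realize v) := by
  simp [meetF, Meet, Formula.realize_not, Formula.realize_inf]

/-- The formula for `ConnSupp`. -/
def connSuppF (c : groupLang.Term α) : groupLang.Formula α :=
  (eqF c oneT).not ⊓ allF ((eqF newT oneT).not.imp ((suppLEF newT (upT c)).imp
    ((allF ((suppLEF newT (upT (upT c))).imp
      ((meetF (mulT (mulT newT (upT newT)) (invT newT)) (upT newT) (upT newT)).imp
        (suppLEF (mulT (mulT newT (upT newT)) (invT newT)) (upT newT))))).imp
      (suppLEF (upT c) newT))))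

@[simp] theorem realize_connSuppF (c : groupLang.Term α) (v : α → G) :
    (connSuppF c).Realize v ↔ ConnSupp (c.realize v) := by
  simp [connSuppF, ConnSupp, Formula.realize_not, Formula.realize_inf, Formula.realize_imp]

/-- The formula for `CompSupp`. -/
def compSuppF (c w : groupLang.Term α) : groupLang.Formula α :=
  connSuppF c ⊓ (suppLEF c w ⊓ allF ((connSuppF newT).imp ((suppLEF newT (upT w)).imp
    ((suppLEF (upT c) newT).imp (suppLEF newT (upT c))))))

@[simp] theorem realize_compSuppF (c w : groupLang.Term α) (v : α → G) :
    (compSuppF c w).Realize v ↔ CompSupp (c.realize v) (w.realize v) := by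
  simp [compSuppF, CompSupp, Formula.realize_inf, Formula.realize_imp]

/-- The formula for `Node`. -/
def nodeF (w u a : groupLang.Term α) : groupLang.Formula α := compSuppF a w ⊓ meetF a u u

@[simp] theorem realize_nodeF (w u a : groupLang.Term α) (v : α → G) :
    (nodeF w u a).Realize v ↔ Node (w.realize v) (u.realize v) (a.realize v) := by
  simp [nodeF, Node, Formula.realize_inf]

/-- The formula for `Adj`. -/
def adjF (u r a b : groupLang.Term α) : groupLang.Formula α :=
  (suppLEF a b).not ⊓ exF (compSuppF newT (upT r) ⊓ (meetF newT (upT a) (upT u) ⊓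
    meetF newT (upT b) (upT u)))

@[simp] theorem realize_adjF (u r a b : groupLang.Term α) (v : α → G) :
    (adjF u r a b).Realize v ↔
      Adj (u.realize v) (r.realize v) (a.realize v) (b.realize v) := by
  simp [adjF, Adj, Formula.realize_not, Formula.realize_inf]

/-- The formula for `UniqueAdj`. -/
def uniqueAdjF (w u r a : groupLang.Term α) : groupLang.Formula α :=
  exF (nodeF (upT w) (upT u) newT ⊓ (adjF (upT u) (upT r) (upT a) newT ⊓
    allF ((nodeF (upT (upT w)) (upT (upT u)) newT).imp
      ((adjF (upT (upT u)) (upT (upT r)) (upT (upT a)) newT).imp (suppLEF (upT newT) newT)))))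

@[simp] theorem realize_uniqueAdjF (w u r a : groupLang.Term α) (v : α → G) :
    (uniqueAdjF w u r a).Realize v ↔
      UniqueAdj (w.realize v) (u.realize v) (r.realize v) (a.realize v) := by
  simp [uniqueAdjF, UniqueAdj, Formula.realize_imp, Formula.realize_inf]

/-- The formula for `InfComp`. -/
def infCompF (w : groupLang.Term α) : groupLang.Formula α :=
  exF (exF (exF (allF ((nodeF (upT (upT (upT (upT w)))) (upT (upT (upT newT))) newT).imp
      (uniqueAdjF (upT (upT (upT (upT w)))) (upT (upT (upT newT))) (upT (upT newT)) newT)) ⊓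
    exF (nodeF (upT (upT (upT (upT w)))) (upT (upT (upT newT))) newT ⊓
      (allF ((nodeF (upT (upT (upT (upT (upT w))))) (upT (upT (upT (upT newT)))) newT).imp
        (adjF (upT (upT (upT (upT newT)))) (upT (upT newT)) (upT newT) newT).not) ⊓
      allF ((nodeF (upT (upT (upT (upT (upT w))))) (upT (upT (upT (upT newT)))) newT).imp
        ((suppLEF newT (upT newT)).not.imp
          (uniqueAdjF (upT (upT (upT (upT (upT w))))) (upT (upT (upT (upT newT))))
            (upT (upT newT)) newT))))))))

@[simp] theorem realize_infCompF (w : groupLang.Term α) (v : α → G) :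
    (infCompF w).Realize v ↔ InfComp (w.realize v) := by
  simp [infCompF, InfComp, Formula.realize_not, Formula.realize_imp, Formula.realize_inf]

end Syntactic

/-! ### Supports and Rubin's commutator relation -/

section Rubin

open Topology
open scoped commutatorElement

variable {G X : Type*} [Group G] [MulAction G X]

theorem commute_of_forall_fixed [FaithfulSMul G X] {a b : G}
    (h : ∀ x : X, a • x = x ∨ b • x = x) : Commute a b := by
  refine FaithfulSMul.eq_of_smul_eq_smul (α := X) fun x => ?_
  rw [mul_smul, mul_smul]
  by_cases ha : a • x = x
  · rw [ha]
    rcases h (b • x) with h1 | h1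
    · exact h1
    · have : b • x = x := smul_left_cancel b h1
      rw [this, ha]
  · have hb := (h x).resolve_left ha
    have : a • a • x ≠ a • x := fun h' => ha (smul_left_cancel a h')
    rw [hb, (h (a • x)).resolve_left this]

theorem exists_smul_ne [FaithfulSMul G X] {g : G} (hg : g ≠ 1) : ∃ x : X, g • x ≠ x := by
  by_contra! h
  exact hg (FaithfulSMul.eq_of_smul_eq_smul (α := X) fun x => by rw [h x, one_smul])

/-- An element that is the identity off `V` maps `V` to itself. -/
theorem smul_mem_of_fixed_off {g : G} {V : Set X} (h : ∀ z ∉ V, g • z = z) {x : X} (hx : x ∈ V) :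
    g • x ∈ V := by
  by_contra h'
  exact h' (by rwa [smul_left_cancel g (h _ h')])

theorem inv_fixed_off {g : G} {V : Set X} (h : ∀ z ∉ V, g • z = z) : ∀ z ∉ V, g⁻¹ • z = z :=
  fun z hz => by rw [inv_smul_eq_iff, h z hz]

variable [TopologicalSpace X]

variable (X) in
/-- The extended support of a group element, for an arbitrary action. -/
def extSupp (g : G) : Set X := interior (closure {x | g • x ≠ x})

variable (G X) in
/-- The action is locally moving: every nonempty open set supports a nontrivial element. -/
def LocallyMoving : Prop :=
  ∀ V : Set X, IsOpen V → V.Nonempty → ∃ g : G, g ≠ 1 ∧ ∀ z ∉ V, g • z = z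

theorem isRegularOpen_extSupp (g : G) : IsRegularOpen (extSupp X g) :=
  subset_antisymm
    (interior_mono ((closure_mono interior_subset).trans_eq isClosed_closure.closure_eq))
    (interior_maximal subset_closure isOpen_interior)

theorem extSupp_subset_of_fixed_off {g : G} {W : Set X} (hW : IsRegularOpen W)
    (h : ∀ z ∉ W, g • z = z) : extSupp X g ⊆ W := by
  refine (interior_mono (closure_mono fun x hx => ?_)).trans_eq hW
  by_contra h'
  exact hx (h x h')

variable [ContinuousConstSMul G X]

theorem isOpen_smul_ne [T2Space X] (g : G) : IsOpen {x : X | g • x ≠ x} :=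
  isOpen_ne_fun (continuous_const_smul g) continuous_id

theorem subset_extSupp [T2Space X] (g : G) : {x : X | g • x ≠ x} ⊆ extSupp X g :=
  interior_maximal subset_closure (isOpen_smul_ne g)

theorem smul_eq_of_notMem_extSupp [T2Space X] {g : G} {x : X} (h : x ∉ extSupp X g) :
    g • x = x := by
  by_contra h'
  exact h (subset_extSupp g h')

theorem exists_open_displaced [T2Space X] (s : Finset G) {x : X} (h : ∀ g ∈ s, g • x ≠ x) :
    ∃ V : Set X, IsOpen V ∧ x ∈ V ∧ ∀ g ∈ s, ∀ z ∈ V, g • z ∉ V := by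
  classical
  induction s using Finset.induction_on with
  | empty => exact ⟨Set.univ, isOpen_univ, trivial, by simp⟩
  | insert g s _ ih =>
    obtain ⟨V, hV, hxV, h1⟩ := ih fun k hk => h k (Finset.mem_insert_of_mem hk)
    obtain ⟨A, B, hA, hB, hxA, hxB, hAB⟩ := t2_separation (h g (Finset.mem_insert_self g s)).symm
    refine ⟨V ∩ (A ∩ (g • ·) ⁻¹' B), hV.inter (hA.inter (hB.preimage (continuous_const_smul g))),
      ⟨hxV, hxA, hxB⟩, fun k hk z hz hz' => ?_⟩
    rcases Finset.mem_insert.1 hk with rfl | hk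
    · exact Set.disjoint_left.1 hAB hz'.2.1 hz.2.2
    · exact h1 k hk z hz.1 hz'.1

/-- A single element `g` displaces a neighbourhood, inside a given open set, of a point that it
moves. -/
theorem exists_open_subset_displaced [T2Space X] {g : G} {x : X} (h : g • x ≠ x) {U : Set X}
    (hU : IsOpen U) (hx : x ∈ U) :
    ∃ V ⊆ U, IsOpen V ∧ x ∈ V ∧ ∀ z ∈ V, g • z ∉ V := by
  obtain ⟨V, hV, hxV, h1⟩ := exists_open_displaced {g} (x := x) (by simpa using h)
  exact ⟨U ∩ V, Set.inter_subset_left, hU.inter hV, ⟨hx, hxV⟩,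
    fun z hz hz' => h1 g (Finset.mem_singleton_self g) z hz.2 hz'.2⟩

/-- A point moved by `g` and by `h` has a neighbourhood `V` that is fixed by `k` and displaced by
`h`. For `f₂ ≠ 1` supported in `V` and `f₁ ≠ 1` supported in a part of `V` displaced by `f₂`, the
double commutator is nontrivial and supported in `V`. -/
theorem algDisjoint_of_forall_fixed [T2Space X] [FaithfulSMul G X] (hG : LocallyMoving G X)
    {g k : G} (hgk : ∀ x : X, g • x = x ∨ k • x = x) : AlgDisjoint g k := by
  intro h hgh
  obtain ⟨x, hgx, hhx⟩ : ∃ x : X, g • x ≠ x ∧ h • x ≠ x := by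
    by_contra! h'
    exact hgh (commute_of_forall_fixed fun x => or_iff_not_imp_left.2 (h' x))
  obtain ⟨V, hVg, hV, hxV, hVh⟩ := exists_open_subset_displaced hhx (isOpen_smul_ne g) hgx
  obtain ⟨f₂, hf₂, hf₂V⟩ := hG V hV ⟨x, hxV⟩
  obtain ⟨y, hy⟩ := exists_smul_ne (X := X) hf₂
  have hyV : y ∈ V := by_contra fun h' => hy (hf₂V y h')
  obtain ⟨V', hV'V, hV', hyV', hV'f⟩ := exists_open_subset_displaced hy hV hyV
  obtain ⟨f₁, hf₁, hf₁V'⟩ := hG V' hV' ⟨y, hyV'⟩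
  have hkV : ∀ z ∈ V, k • z = z := fun z hz => (hgk z).resolve_left (hVg hz)
  have hf₁V : ∀ z ∉ V, f₁ • z = z := fun z hz => hf₁V' z fun h' => hz (hV'V h')
  have key : ∀ a : G, (∀ z ∉ V, a • z = z) → Commute a k := fun a ha =>
    commute_of_forall_fixed fun z => by
      by_cases hz : z ∈ V
      · exact Or.inr (hkV z hz)
      · exact Or.inl (ha z hz)
  -- on `V` the commutator `⁅f₂, h⁆` acts as `f₂`
  have hd : ∀ z ∈ V, ⁅f₂, h⁆ • z = f₂ • z := by
    intro z hz
    have h1 : h⁻¹ • z ∉ V := fun h' => hVh _ h' (by rwa [smul_inv_smul])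
    simp [commutatorElement_def, mul_smul, inv_fixed_off hf₂V _ h1]
  refine ⟨f₁, f₂, key f₁ hf₁V, key f₂ hf₂V, fun hc => ?_, key _ fun z hz => ?_⟩
  · obtain ⟨z, hz⟩ := exists_smul_ne (X := X) hf₁
    have hzV' : z ∈ V' := by_contra fun h' => hz (hf₁V' z h')
    have hcomm := congrArg (· • z) (commutatorElement_eq_one_iff_mul_comm.1 hc)
    simp only [mul_smul] at hcomm
    rw [hd _ (hV'V hzV'), hd _ (hV'V (smul_mem_of_fixed_off hf₁V' hzV')),
      hf₁V' _ (hV'f z hzV')] at hcomm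
    exact hz (smul_left_cancel f₂ hcomm).symm
  · have h1 : ⁅f₂, h⁆⁻¹ • z ∉ V := by
      intro h'
      have := hd _ h'
      rw [smul_inv_smul] at this
      rw [this] at hz
      exact hz (smul_mem_of_fixed_off hf₂V h')
    rw [commutatorElement_def f₁, mul_smul, mul_smul, mul_smul, inv_fixed_off hf₁V _ h1,
      smul_inv_smul, hf₁V z hz]

/-- If `k ^ 12` moves `x`, then so do `k, k², k³, k⁴`, and some neighbourhood `V` of `x` is
displaced by `g` and by these four powers. For `h` supported in `V` the nontrivial commutator
`⁅f₁, ⁅f₂, h⁆⁆` is supported in four translates of `V` by elements of the centralizer of `k`. None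
of these contains two of the five points `y, k y, …, k⁴ y`, all of which are moved by the commutator
if `y` is. -/
theorem pow_smul_eq_of_algDisjoint [T2Space X] [FaithfulSMul G X] (hG : LocallyMoving G X)
    {g k : G} (hgk : AlgDisjoint g k) {x : X} (hx : g • x ≠ x) : k ^ 12 • x = x := by
  classical
  by_contra hk
  have hpow : ∀ i ∈ Finset.Icc 1 4, k ^ i • x ≠ x := by
    intro i hi h'
    have hdvd : i ∣ 12 := by
      rw [Finset.mem_Icc] at hi
      obtain ⟨h1, h2⟩ := hi
      interval_cases i <;> decide
    obtain ⟨m, hm⟩ := hdvd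
    refine hk ?_
    rw [hm, pow_mul]
    exact (MulAction.stabilizer G x).pow_mem (x := k ^ i) h' m
  obtain ⟨V, hV, hxV, hVs⟩ := exists_open_displaced
    (insert g ((Finset.Icc 1 4).image fun i => k ^ i)) (x := x) (by
      intro a ha
      rcases Finset.mem_insert.1 ha with rfl | ha
      · exact hx
      · obtain ⟨i, hi, rfl⟩ := Finset.mem_image.1 ha
        exact hpow i hi)
  have hVg := hVs g (Finset.mem_insert_self _ _)
  have hVk : ∀ i ∈ Finset.Icc 1 4, ∀ z ∈ V, k ^ i • z ∉ V := fun i hi =>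
    hVs _ (Finset.mem_insert_of_mem (Finset.mem_image_of_mem _ hi))
  obtain ⟨h, hh1, hhV⟩ := hG V hV ⟨x, hxV⟩
  have hgh : ¬ Commute g h := by
    intro hc
    obtain ⟨y, hy⟩ := exists_smul_ne (X := X) hh1
    have hyV : y ∈ V := by_contra fun h' => hy (hhV y h')
    have := congrArg (· • y) hc.eq
    simp only [mul_smul] at this
    rw [hhV _ (hVg y hyV)] at this
    exact hy (smul_left_cancel g this)
  obtain ⟨f₁, f₂, h1, h2, hc1, hck⟩ := hgk h hgh
  obtain ⟨y, hy⟩ := exists_smul_ne (X := X) hc1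
  let u : Fin 4 → G := ![1, f₂, f₁, f₁ * f₂]
  have hu : ∀ j, Commute (u j) k := by
    intro j
    fin_cases j
    · exact Commute.one_left k
    · exact h2
    · exact h1
    · exact h1.mul_left h2
  have hcov : ∀ y : X, ⁅f₁, ⁅f₂, h⁆⁆ • y ≠ y → ∃ j, (u j)⁻¹ • y ∈ V := by
    intro y hy
    by_contra! hj
    have hj0 : y ∉ V := by simpa [u] using hj 0
    have hj1 : f₂⁻¹ • y ∉ V := by simpa [u] using hj 1
    have hj2 : f₁⁻¹ • y ∉ V := by simpa [u] using hj 2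
    have hj3 : f₂⁻¹ • f₁⁻¹ • y ∉ V := by simpa [u, mul_smul] using hj 3
    apply hy
    simp [commutatorElement_def, mul_smul, inv_fixed_off hhV _ hj1, hhV _ hj0,
      inv_fixed_off hhV _ hj2, hhV _ hj3]
  have hmove : ∀ i : Fin 5, ⁅f₁, ⁅f₂, h⁆⁆ • k ^ (i : ℕ) • y ≠ k ^ (i : ℕ) • y := by
    intro i h'
    rw [← mul_smul, (hck.pow_right i).eq, mul_smul] at h'
    exact hy (smul_left_cancel _ h')
  choose j hj using fun i : Fin 5 => hcov _ (hmove i)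
  obtain ⟨a, b, hab, hjab⟩ := Fintype.exists_ne_map_eq_of_card_lt j (by simp)
  have main : ∀ a b : Fin 5, a < b → j a = j b → False := by
    intro a b hab hjab
    have hb := hj b
    rw [← hjab] at hb
    refine hVk (b - a) (Finset.mem_Icc.2 ⟨by omega, by omega⟩) _ (hj a) ?_
    have e : k ^ (b - a : ℕ) * (u (j a))⁻¹ * k ^ (a : ℕ) = (u (j a))⁻¹ * k ^ (b : ℕ) := by
      rw [((hu (j a)).symm.inv_right.pow_left _).eq, mul_assoc, ← pow_add]
      congr 2
      omega
    rw [← mul_smul, ← mul_smul, e, mul_smul]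
    exact hb
  rcases lt_or_gt_of_ne hab with hlt | hlt
  · exact main a b hlt hjab
  · exact main b a hlt hjab.symm

/-- In a locally moving group every open set supports elements with long orbits. -/
theorem exists_forall_pow_smul_ne [T2Space X] [FaithfulSMul G X] (hG : LocallyMoving G X)
    {V : Set X} (hV : IsOpen V) (hne : V.Nonempty) (m : ℕ) :
    ∃ a : G, (∀ z ∉ V, a • z = z) ∧ ∃ x ∈ V, ∀ i ∈ Finset.Icc 1 m, a ^ i • x ≠ x := by
  classical
  induction m with
  | zero =>
    obtain ⟨x, hx⟩ := hne
    exact ⟨1, fun z _ => one_smul G z, x, hx, by simp⟩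
  | succ m ih =>
    obtain ⟨a, haV, x, hxV, hax⟩ := ih
    obtain ⟨V₁, hV₁, hxV₁, hV₁a⟩ := exists_open_displaced
      ((Finset.Icc 1 m).image fun i => a ^ i) (x := x) (by
        intro b hb
        obtain ⟨i, hi, rfl⟩ := Finset.mem_image.1 hb
        exact hax i hi)
    have hdisp : ∀ i ∈ Finset.Icc 1 m, ∀ z ∈ V ∩ V₁, a ^ i • z ∉ V ∩ V₁ := fun i hi z hz hz' =>
      hV₁a _ (Finset.mem_image_of_mem _ hi) z hz.2 hz'.2
    obtain ⟨b, hb1, hbV⟩ := hG (V ∩ V₁) (hV.inter hV₁) ⟨x, hxV, hxV₁⟩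
    obtain ⟨y, hy⟩ := exists_smul_ne (X := X) hb1
    have hyV : y ∈ V ∩ V₁ := by_contra fun h' => hy (hbV y h')
    by_cases hay : a ^ (m + 1) • y = y
    · -- the product `a * b` follows the orbit of `b • y` under `a`, which returns to `b • y ≠ y`
      have horb : ∀ i ≤ m, (a * b) ^ (i + 1) • y = a ^ (i + 1) • b • y := by
        intro i hi
        induction i with
        | zero => simp [mul_smul]
        | succ i ih =>
          rw [pow_succ' _ (i + 1), mul_smul, ih (by omega), mul_smul,
            hbV _ (hdisp (i + 1) (Finset.mem_Icc.2 ⟨by omega, hi⟩) _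
              (smul_mem_of_fixed_off hbV hyV)), ← mul_smul, ← pow_succ']
      refine ⟨a * b, fun z hz => ?_, y, hyV.1, fun i hi => ?_⟩
      · rw [mul_smul, hbV z fun h' => hz h'.1, haV z hz]
      · rw [Finset.mem_Icc] at hi
        obtain ⟨i, rfl⟩ : ∃ l, i = l + 1 := ⟨i - 1, by omega⟩
        rw [horb i (by omega)]
        intro h'
        rcases (by omega : i < m ∨ i = m) with hlt | rfl
        · exact hdisp (i + 1) (Finset.mem_Icc.2 ⟨by omega, hlt⟩) _
            (smul_mem_of_fixed_off hbV hyV) (by rwa [h'])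
        · exact hy (smul_left_cancel _ (h'.trans hay.symm))
    · refine ⟨a, haV, y, hyV.1, fun i hi => ?_⟩
      rw [Finset.mem_Icc] at hi
      rcases (by omega : i ≤ m ∨ i = m + 1) with hlt | rfl
      · intro h'
        exact hdisp i (Finset.mem_Icc.2 ⟨hi.1, hlt⟩) y hyV (by rwa [h'])
      · exact hay

/-- Inclusion of extended supports is a first-order property. -/
theorem suppLE_iff [T2Space X] [FaithfulSMul G X] (hG : LocallyMoving G X) {f g : G} :
    SuppLE f g ↔ extSupp X f ⊆ extSupp X g := by
  constructor
  · intro h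
    suffices {x : X | f • x ≠ x} ⊆ closure {x | g • x ≠ x} from
      interior_mono ((closure_mono this).trans_eq isClosed_closure.closure_eq)
    intro x hx
    by_contra hxg
    obtain ⟨V, hVU, hV, hxV, hVf⟩ :=
      exists_open_subset_displaced hx isClosed_closure.isOpen_compl hxg
    obtain ⟨k, hkV, y, hyV, hky⟩ := exists_forall_pow_smul_ne hG hV ⟨x, hxV⟩ 12
    have hgk : AlgDisjoint g k := algDisjoint_of_forall_fixed hG fun z => by
      by_cases hz : z ∈ V
      · exact Or.inl (by_contra fun h' => hVU hz (subset_closure h'))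
      · exact Or.inr (hkV z hz)
    have hk12 : ∀ z ∉ V, k ^ 12 • z = z := fun z hz =>
      (MulAction.stabilizer G z).pow_mem (x := k) (hkV z hz) 12
    have hc := congrArg (· • y) (h k hgk).eq
    simp only [mul_smul] at hc
    rw [hk12 _ (hVf y hyV)] at hc
    exact hky 12 (by simp) (smul_left_cancel f hc)
  · intro h k hgk
    refine commute_of_forall_fixed (X := X) fun x => ?_
    by_contra! hx
    have hxg : x ∈ closure {x | g • x ≠ x} := interior_subset (h (subset_extSupp f hx.1))
    obtain ⟨z, hz1, hz2⟩ := mem_closure_iff.1 hxg _ (isOpen_smul_ne (k ^ 12)) hx.2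
    exact hz1 (pow_smul_eq_of_algDisjoint hG hgk hz2)

end Rubin

/-! ### Connected components of regular open sets -/

section Components

open Topology

variable {X : Type*} [TopologicalSpace X]

/-- `C` is a connected component of the subset `W`. -/
def IsComponent (C W : Set X) : Prop := ∃ x ∈ W, C = connectedComponentIn W x

theorem IsRegularOpen.isOpen {W : Set X} (hW : IsRegularOpen W) : IsOpen W :=
  hW ▸ isOpen_interior

theorem isRegularOpen_interior_of_isClosed {F : Set X} (hF : IsClosed F) :
    IsRegularOpen (interior F) :=
  subset_antisymm (interior_mono (closure_minimal interior_subset hF))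
    (interior_maximal subset_closure isOpen_interior)

theorem IsComponent.subset {C W : Set X} (h : IsComponent C W) : C ⊆ W := by
  obtain ⟨x, _, rfl⟩ := h
  exact connectedComponentIn_subset W x

theorem IsComponent.isConnected {C W : Set X} (h : IsComponent C W) : IsConnected C := by
  obtain ⟨x, hx, rfl⟩ := h
  exact isConnected_connectedComponentIn_iff.2 hx

theorem IsComponent.eq_connectedComponentIn {C W : Set X} (h : IsComponent C W) {x : X}
    (hx : x ∈ C) : C = connectedComponentIn W x := by
  obtain ⟨y, _, rfl⟩ := h
  exact connectedComponentIn_eq hx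

theorem IsComponent.eq_of_mem {C D W : Set X} (hC : IsComponent C W) (hD : IsComponent D W)
    {x : X} (hxC : x ∈ C) (hxD : x ∈ D) : C = D :=
  (hC.eq_connectedComponentIn hxC).trans (hD.eq_connectedComponentIn hxD).symm

theorem IsComponent.eq_of_subset {C D W : Set X} (hC : IsComponent C W) (hD : IsComponent D W)
    (h : C ⊆ D) : C = D :=
  let ⟨_, hx⟩ := hC.isConnected.nonempty
  hC.eq_of_mem hD hx (h hx)

theorem IsComponent.subset_of_isPreconnected {C D W : Set X} (hC : IsComponent C W)
    (hD : IsPreconnected D) (hDW : D ⊆ W) {x : X} (hxC : x ∈ C) (hxD : x ∈ D) : D ⊆ C := by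
  rw [hC.eq_connectedComponentIn hxC]
  exact hD.subset_connectedComponentIn hxD hDW

theorem IsComponent.isOpen [LocallyConnectedSpace X] {C W : Set X} (h : IsComponent C W)
    (hW : IsOpen W) : IsOpen C := by
  obtain ⟨x, _, rfl⟩ := h
  exact hW.connectedComponentIn

theorem isComponent_connectedComponentIn {W : Set X} {x : X} (hx : x ∈ W) :
    IsComponent (connectedComponentIn W x) W := ⟨x, hx, rfl⟩

/-- The closure of a component of `W` does not meet the other ones, because they are open. -/
theorem IsComponent.isRegularOpen [LocallyConnectedSpace X] {C W : Set X} (h : IsComponent C W)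
    (hW : IsRegularOpen W) : IsRegularOpen C := by
  refine subset_antisymm (fun y hy => ?_)
    (interior_maximal subset_closure (h.isOpen hW.isOpen))
  have hyW : y ∈ W := hW ▸ interior_mono (closure_mono h.subset) hy
  have hD := isComponent_connectedComponentIn hyW
  have hyD : y ∈ connectedComponentIn W y := mem_connectedComponentIn hyW
  obtain ⟨z, hzD, hzC⟩ := mem_closure_iff.1 (interior_subset hy) _ (hD.isOpen hW.isOpen) hyD
  rwa [h.eq_of_mem hD hzC hzD]

theorem infinite_connectedComponents_iff (W : Set X) :
    Infinite (ConnectedComponents W) ↔ {C | IsComponent C W}.Infinite := by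
  let f : ConnectedComponents W → Set X :=
    Quotient.lift (fun x : W => connectedComponentIn W x) fun x y hxy => by
      have hxy : connectedComponent x = connectedComponent y := hxy
      simp only [connectedComponentIn_eq_image x.2, connectedComponentIn_eq_image y.2]
      exact congrArg _ hxy
  have hf : Function.Injective f := by
    intro a b
    induction a using Quotient.inductionOn
    induction b using Quotient.inductionOn
    rename_i x y
    intro h
    have h : connectedComponentIn W (x : X) = connectedComponentIn W y := h
    rw [connectedComponentIn_eq_image x.2, connectedComponentIn_eq_image y.2] at h
    exact Quotient.sound (Subtype.val_injective.image_injective h)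
  have hr : Set.range f = {C | IsComponent C W} := by
    ext C
    constructor
    · rintro ⟨a, rfl⟩
      induction a using Quotient.inductionOn
      rename_i x
      exact ⟨x, x.2, rfl⟩
    · rintro ⟨x, hx, rfl⟩
      exact ⟨Quotient.mk _ ⟨x, hx⟩, rfl⟩
  rw [← hr, Set.infinite_range_iff hf]

end Components

/-! ### First-order recognition of components -/

section Recognition

open Topology

variable {G X : Type*} [Group G] [MulAction G X] [TopologicalSpace X]

variable (G X) in
/-- Every regular open set is the extended support of a group element. -/
def RealizesRegularOpen : Prop :=
  ∀ W : Set X, IsRegularOpen W → ∃ g : G, extSupp X g = W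

variable (G X) in
/-- Nearby points can be mapped to each other by group elements with small support. -/
def LocallyMixing : Prop :=
  ∀ p : X, ∀ N ∈ 𝓝 p, ∃ N' ∈ 𝓝 p, ∀ x ∈ N', ∀ y ∈ N', ∃ g : G, g • x = y ∧ ∀ z ∉ N, g • z = z

variable [ContinuousConstSMul G X]

theorem mem_extSupp_conj {g d : G} {x : X} :
    x ∈ extSupp X (g * d * g⁻¹) ↔ g⁻¹ • x ∈ extSupp X d := by
  have h : {x : X | (g * d * g⁻¹) • x ≠ x} = Homeomorph.smul g⁻¹ ⁻¹' {x | d • x ≠ x} := by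
    ext z
    simp [mul_smul, smul_eq_iff_eq_inv_smul g]
  rw [extSupp, h, ← Homeomorph.preimage_closure, ← Homeomorph.preimage_interior]
  rfl

variable [T2Space X] [FaithfulSMul G X]

variable (X) in
theorem extSupp_nonempty_iff {g : G} : (extSupp X g).Nonempty ↔ g ≠ 1 := by
  constructor
  · rintro ⟨x, hx⟩ rfl
    simp [extSupp] at hx
  · intro h
    obtain ⟨x, hx⟩ := exists_smul_ne (X := X) h
    exact ⟨x, subset_extSupp g hx⟩

theorem RealizesRegularOpen.locallyMoving [RegularSpace X] (hG : RealizesRegularOpen G X) :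
    LocallyMoving G X := by
  rintro V hV ⟨x, hx⟩
  obtain ⟨t, ht, htc, htV⟩ := exists_mem_nhds_isClosed_subset (hV.mem_nhds hx)
  obtain ⟨g, hg⟩ := hG _ (isRegularOpen_interior_of_isClosed htc)
  have hgt : (extSupp X g).Nonempty := hg ▸ ⟨x, mem_interior_iff_mem_nhds.2 ht⟩
  refine ⟨g, (extSupp_nonempty_iff X).1 hgt, fun z hz => ?_⟩
  exact smul_eq_of_notMem_extSupp fun h => hz (htV (interior_subset (hg ▸ h)))

theorem meet_iff (hG : LocallyMoving G X) {a b c : G} :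
    Meet a b c ↔ (extSupp X a ∩ extSupp X b ∩ extSupp X c).Nonempty := by
  simp only [Meet, suppLE_iff (X := X) hG]
  constructor
  · rintro ⟨k, hk, ha, hb, hc⟩
    obtain ⟨x, hx⟩ := (extSupp_nonempty_iff X).2 hk
    exact ⟨x, ⟨ha hx, hb hx⟩, hc hx⟩
  · intro h
    obtain ⟨k, hk, hkV⟩ := hG _ ((isOpen_interior.inter isOpen_interior).inter isOpen_interior) h
    exact ⟨k, hk, extSupp_subset_of_fixed_off (isRegularOpen_extSupp a) fun z hz => hkV z fun h =>
        hz h.1.1, extSupp_subset_of_fixed_off (isRegularOpen_extSupp b) fun z hz => hkV z fun h =>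
        hz h.1.2, extSupp_subset_of_fixed_off (isRegularOpen_extSupp c) fun z hz => hkV z fun h =>
        hz h.2⟩

/-- If the support of `c` is connected, then a proper piece of it has a boundary point inside, near
which a small element moves part of the piece out of the piece. If it is not, then any component
is a block. -/
theorem connSupp_iff [LocallyConnectedSpace X] (hG : LocallyMoving G X)
    (hR : RealizesRegularOpen G X) (hM : LocallyMixing G X) {c : G} :
    ConnSupp c ↔ IsConnected (extSupp X c) := by
  rw [ConnSupp, IsConnected, extSupp_nonempty_iff X]
  refine and_congr_right fun hc1 => ?_
  simp only [suppLE_iff (X := X) hG, meet_iff (X := X) hG, Set.inter_assoc, Set.inter_self]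
  constructor
  · intro h
    obtain ⟨x, hx⟩ := (extSupp_nonempty_iff X).2 hc1
    have hreg := isRegularOpen_extSupp (X := X) c
    have hC := isComponent_connectedComponentIn hx
    obtain ⟨d, hd⟩ := hR _ (hC.isRegularOpen hreg)
    rw [← hd] at hC
    have hcd : extSupp X c ⊆ extSupp X d := by
      refine h d ((extSupp_nonempty_iff X).1 hC.isConnected.nonempty) hC.subset ?_
      rintro g hg ⟨y, hy, hyd⟩ z hz
      rw [mem_extSupp_conj] at hy hz
      have hgd : IsPreconnected ((g • ·) '' extSupp X d) :=
        hC.isConnected.isPreconnected.image _ (continuous_const_smul g).continuousOn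
      refine hC.subset_of_isPreconnected hgd ?_ hyd ⟨_, hy, smul_inv_smul g y⟩
        ⟨_, hz, smul_inv_smul g z⟩
      rintro _ ⟨t, ht, rfl⟩
      exact smul_mem_of_fixed_off (fun z hz => smul_eq_of_notMem_extSupp fun h => hz (hg h))
        (hC.subset ht)
    rw [hcd.antisymm hC.subset]
    exact hC.isConnected.isPreconnected
  · intro h d hd1 hdc hblock
    by_contra hcd
    have hreg := isRegularOpen_extSupp (X := X) d
    obtain ⟨q, hq⟩ := (extSupp_nonempty_iff X).2 hd1
    obtain ⟨p, hpc, hp⟩ : ∃ p ∈ extSupp X c, p ∈ closure (extSupp X d) \ extSupp X d := by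
      by_contra! hno
      refine hcd fun y hy => ?_
      by_contra hyd
      obtain ⟨z, -, hz1, hz2⟩ := h _ (closure (extSupp X d))ᶜ hreg.isOpen
        isClosed_closure.isOpen_compl
        (fun z hz => by
          by_cases hz' : z ∈ extSupp X d
          · exact Or.inl hz'
          · exact Or.inr fun h' => hno z hz ⟨h', hz'⟩) ⟨q, hdc hq, hq⟩
        ⟨y, hy, fun h' => hno y hy ⟨h', hyd⟩⟩
      exact hz2 (subset_closure hz1)
    have hpq : p ≠ q := fun h' => hp.2 (h' ▸ hq)
    have hN : extSupp X c ∩ {q}ᶜ ∈ 𝓝 p :=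
      Filter.inter_mem (isOpen_interior.mem_nhds hpc) (isOpen_compl_singleton.mem_nhds hpq)
    obtain ⟨N', hN', hmix⟩ := hM p _ hN
    obtain ⟨x, hxN', hx⟩ := mem_closure_iff_nhds.1 hp.1 N' hN'
    obtain ⟨y, hyN', hy⟩ : ∃ y ∈ N', y ∉ extSupp X d := by
      by_contra! hsub
      refine hp.2 (hreg ▸ ?_)
      exact mem_interior_iff_mem_nhds.2 (Filter.mem_of_superset hN' fun z hz =>
        subset_closure (hsub z hz))
    obtain ⟨g, hgx, hg⟩ := hmix x hxN' y hyN'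
    have hgq : g • q = q := hg q fun h' => h'.2 rfl
    refine hy (hblock g (extSupp_subset_of_fixed_off (isRegularOpen_extSupp c) fun z hz =>
      hg z fun h' => hz h'.1) ⟨q, ?_, hq⟩ ?_)
    · rwa [mem_extSupp_conj, inv_smul_eq_iff.2 hgq.symm]
    · rwa [mem_extSupp_conj, inv_smul_eq_iff.2 hgx.symm]

theorem compSupp_iff [LocallyConnectedSpace X] (hG : LocallyMoving G X)
    (hR : RealizesRegularOpen G X) (hM : LocallyMixing G X) {c w : G} :
    CompSupp c w ↔ IsComponent (extSupp X c) (extSupp X w) := by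
  simp only [CompSupp, connSupp_iff (X := X) hG hR hM, suppLE_iff (X := X) hG]
  constructor
  · rintro ⟨hc, hcw, hmax⟩
    obtain ⟨x, hx⟩ := hc.nonempty
    have hC := isComponent_connectedComponentIn (hcw hx)
    obtain ⟨d, hd⟩ := hR _ (hC.isRegularOpen (isRegularOpen_extSupp w))
    have hsub : extSupp X c ⊆ extSupp X d :=
      hd ▸ hc.isPreconnected.subset_connectedComponentIn hx hcw
    rw [← hd] at hC
    exact hsub.antisymm (hmax d hC.isConnected hC.subset hsub) ▸ hC
  · intro h
    obtain ⟨x, hx⟩ := h.isConnected.nonempty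
    exact ⟨h.isConnected, h.subset, fun d hd hdw hcd =>
      h.subset_of_isPreconnected hd.isPreconnected hdw hx (hcd hx)⟩

end Recognition

/-! ### Two matchings that force infinitely many components -/

section Matchings

/-- In a symmetric irreflexive relation on a finite type, the number of points is even that have
exactly one neighbour, if the other points have none. -/
theorem even_card_of_matching {V : Type*} [Fintype V] (r : V → V → Prop)
    (hsymm : ∀ a b, r a b → r b a) (hirr : ∀ a, ¬ r a a) (T : Finset V)
    (hT : ∀ a ∈ T, ∃! b, r a b) (hT' : ∀ a ∉ T, ∀ b, ¬ r a b) : Even T.card := by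
  classical
  let Γ : SimpleGraph V := ⟨r, ⟨hsymm⟩, ⟨hirr⟩⟩
  have hdeg : ∀ a, Γ.degree a = if a ∈ T then 1 else 0 := by
    intro a
    rw [← SimpleGraph.card_neighborFinset_eq_degree]
    split_ifs with ha
    · obtain ⟨b, hb, huniq⟩ := hT a ha
      refine Finset.card_eq_one.2 ⟨b, ?_⟩
      ext c
      rw [SimpleGraph.mem_neighborFinset, Finset.mem_singleton]
      exact ⟨fun h => huniq c h, fun h => h ▸ hb⟩
    · refine Finset.card_eq_zero.2 (Finset.eq_empty_of_forall_notMem fun c hc => ?_)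
      rw [SimpleGraph.mem_neighborFinset] at hc
      exact hT' a ha c hc
  have hsum := Γ.sum_degrees_eq_twice_card_edges
  simp only [hdeg, Finset.sum_ite_mem, Finset.univ_inter, Finset.sum_const, smul_eq_mul,
    mul_one] at hsum
  exact ⟨_, hsum.trans (two_mul _)⟩

variable {X : Type*} [TopologicalSpace X]

/-- `A` is a component of `W` that meets the marker set `U`. -/
def IsNode (W U A : Set X) : Prop := IsComponent A W ∧ (A ∩ U).Nonempty

/-- The different sets `A` and `B` are joined by a component of `R` that meets the marked parts of
both. -/
def AreJoined (U R A B : Set X) : Prop :=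
  A ≠ B ∧ ∃ P, IsComponent P R ∧ (P ∩ (A ∩ U)).Nonempty ∧ (P ∩ (B ∩ U)).Nonempty

/-- The components of `W` that meet `U` are perfectly matched by `R`, whereas `S` matches all but
one of them. -/
def HasMatchings (W U R S : Set X) : Prop :=
  (∀ A, IsNode W U A → ∃! B, IsNode W U B ∧ AreJoined U R A B) ∧
    ∃ O, IsNode W U O ∧ (∀ B, IsNode W U B → ¬ AreJoined U S O B) ∧
      ∀ A, IsNode W U A → A ≠ O → ∃! B, IsNode W U B ∧ AreJoined U S A B

/-- The number of components that meet `U` would be even because of `R`, and odd because of `S`. -/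
theorem HasMatchings.infinite {W U R S : Set X} (h : HasMatchings W U R S) :
    {C | IsComponent C W}.Infinite := by
  classical
  intro hfin
  obtain ⟨hR, O, hO, hSO, hS⟩ := h
  have : Finite {A // IsNode W U A} := hfin.subset fun A hA => hA.1
  have := Fintype.ofFinite {A // IsNode W U A}
  have hsymm : ∀ R : Set X, ∀ a b : {A // IsNode W U A},
      AreJoined U R a b → AreJoined U R b a :=
    fun R a b ⟨h1, P, hP, h2, h3⟩ => ⟨h1.symm, P, hP, h3, h2⟩
  have hsub : ∀ R : Set X, ∀ a : {A // IsNode W U A},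
      (∃! B, IsNode W U B ∧ AreJoined U R a B) →
        ∃! b : {A // IsNode W U A}, AreJoined U R a b := by
    rintro R a ⟨B, ⟨hB, haB⟩, huniq⟩
    exact ⟨⟨B, hB⟩, haB, fun c hc => Subtype.ext (huniq c ⟨c.2, hc⟩)⟩
  have h1 := even_card_of_matching (fun a b : {A // IsNode W U A} => AreJoined U R a b)
    (hsymm R) (fun a h => h.1 rfl) Finset.univ (fun a _ => hsub R a (hR a a.2)) (by simp)
  have h2 := even_card_of_matching (fun a b : {A // IsNode W U A} => AreJoined U S a b)
    (hsymm S) (fun a h => h.1 rfl) (Finset.univ.erase ⟨O, hO⟩)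
    (fun a ha => hsub S a (hS a a.2 fun h => Finset.ne_of_mem_erase ha (Subtype.ext h)))
    (fun a ha b => by
      have : a = ⟨O, hO⟩ := by simpa using ha
      subst this
      exact hSO b b.2)
  rw [Finset.card_erase_of_mem (Finset.mem_univ _)] at h2
  have hpos : 0 < (Finset.univ : Finset {A // IsNode W U A}).card :=
    Finset.card_pos.2 ⟨⟨O, hO⟩, Finset.mem_univ _⟩
  obtain ⟨m, hm⟩ := h1
  obtain ⟨l, hl⟩ := h2
  omega

variable {G : Type*} [Group G] [MulAction G X] [ContinuousConstSMul G X] [T2Space X]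
  [FaithfulSMul G X] [LocallyConnectedSpace X]

theorem node_iff (hG : LocallyMoving G X) (hR : RealizesRegularOpen G X)
    (hM : LocallyMixing G X) {w u a : G} :
    Node w u a ↔ IsNode (extSupp X w) (extSupp X u) (extSupp X a) := by
  rw [Node, IsNode, compSupp_iff (X := X) hG hR hM, meet_iff (X := X) hG, Set.inter_assoc,
    Set.inter_self]

theorem adj_iff (hG : LocallyMoving G X) (hR : RealizesRegularOpen G X)
    (hM : LocallyMixing G X) {w u r a b : G}
    (ha : IsComponent (extSupp X a) (extSupp X w)) (hb : IsComponent (extSupp X b) (extSupp X w)) :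
    Adj u r a b ↔ AreJoined (extSupp X u) (extSupp X r) (extSupp X a) (extSupp X b) := by
  simp only [Adj, AreJoined, compSupp_iff (X := X) hG hR hM, meet_iff (X := X) hG,
    suppLE_iff (X := X) hG, Set.inter_assoc]
  refine and_congr (not_congr ⟨fun h => ha.eq_of_subset hb h, fun h => h.subset⟩) ⟨?_, ?_⟩
  · rintro ⟨ρ, h⟩
    exact ⟨_, h⟩
  · rintro ⟨P, hP, h⟩
    obtain ⟨ρ, rfl⟩ := hR P (hP.isRegularOpen (isRegularOpen_extSupp r))
    exact ⟨ρ, hP, h⟩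

theorem uniqueAdj_iff (hG : LocallyMoving G X) (hR : RealizesRegularOpen G X)
    (hM : LocallyMixing G X) {w u r a : G}
    (ha : IsNode (extSupp X w) (extSupp X u) (extSupp X a)) :
    UniqueAdj w u r a ↔ ∃! B, IsNode (extSupp X w) (extSupp X u) B ∧
      AreJoined (extSupp X u) (extSupp X r) (extSupp X a) B := by
  simp only [UniqueAdj, node_iff (X := X) hG hR hM, suppLE_iff (X := X) hG]
  constructor
  · rintro ⟨b, hb, hab, huniq⟩
    refine ⟨_, ⟨hb, (adj_iff hG hR hM ha.1 hb.1).1 hab⟩, ?_⟩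
    rintro C ⟨hC, haC⟩
    obtain ⟨c, rfl⟩ := hR C (hC.1.isRegularOpen (isRegularOpen_extSupp w))
    exact (hb.1.eq_of_subset hC.1 (huniq c hC ((adj_iff hG hR hM ha.1 hC.1).2 haC))).symm
  · rintro ⟨B, ⟨hB, haB⟩, huniq⟩
    obtain ⟨b, rfl⟩ := hR B (hB.1.isRegularOpen (isRegularOpen_extSupp w))
    refine ⟨b, hB, (adj_iff hG hR hM ha.1 hB.1).2 haB, fun c hc hac => ?_⟩
    exact (huniq _ ⟨hc, (adj_iff hG hR hM ha.1 hc.1).1 hac⟩).ge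

theorem infComp_iff (hG : LocallyMoving G X) (hR : RealizesRegularOpen G X)
    (hM : LocallyMixing G X) {w : G} :
    InfComp w ↔ ∃ U R S : Set X, IsRegularOpen U ∧ IsRegularOpen R ∧ IsRegularOpen S ∧
      HasMatchings (extSupp X w) U R S := by
  have realize : ∀ {u A}, IsNode (extSupp X w) u A → ∃ a : G, extSupp X a = A := fun hA =>
    hR _ (hA.1.isRegularOpen (isRegularOpen_extSupp w))
  have key : ∀ u r s : G, ((∀ a, Node w u a → UniqueAdj w u r a) ∧
      ∃ o, Node w u o ∧ (∀ b, Node w u b → ¬ Adj u s o b) ∧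
        ∀ a, Node w u a → ¬ SuppLE a o → UniqueAdj w u s a) ↔
      HasMatchings (extSupp X w) (extSupp X u) (extSupp X r) (extSupp X s) := by
    intro u r s
    simp only [HasMatchings, node_iff (X := X) hG hR hM, suppLE_iff (X := X) hG]
    refine and_congr ⟨fun h A hA => ?_, fun h a ha => ?_⟩ ⟨?_, ?_⟩
    · obtain ⟨a, rfl⟩ := realize hA
      exact (uniqueAdj_iff hG hR hM hA).1 (h a hA)
    · exact (uniqueAdj_iff hG hR hM ha).2 (h _ ha)
    · rintro ⟨o, ho, h1, h2⟩
      refine ⟨_, ho, fun B hB hoB => ?_, fun A hA hAo => ?_⟩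
      · obtain ⟨b, rfl⟩ := realize hB
        exact h1 b hB ((adj_iff hG hR hM ho.1 hB.1).2 hoB)
      · obtain ⟨a, rfl⟩ := realize hA
        exact (uniqueAdj_iff hG hR hM hA).1
          (h2 a hA fun h => hAo (hA.1.eq_of_subset ho.1 h))
    · rintro ⟨O, hO, h1, h2⟩
      obtain ⟨o, rfl⟩ := realize hO
      exact ⟨o, hO, fun b hb hob => h1 _ hb ((adj_iff hG hR hM hO.1 hb.1).1 hob),
        fun a ha hao => (uniqueAdj_iff hG hR hM ha).2 (h2 _ ha fun h => hao h.subset)⟩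
  constructor
  · rintro ⟨u, r, s, h⟩
    exact ⟨_, _, _, isRegularOpen_extSupp u, isRegularOpen_extSupp r, isRegularOpen_extSupp s,
      (key u r s).1 h⟩
  · rintro ⟨U, R, S, hU, hR', hS, h⟩
    obtain ⟨u, rfl⟩ := hR U hU
    obtain ⟨r, rfl⟩ := hR R hR'
    obtain ⟨s, rfl⟩ := hR S hS
    exact ⟨u, r, s, (key u r s).2 h⟩

end Matchings

/-! ### Slabs in a chart -/

section Slabs

open Topology

variable {X : Type*} [TopologicalSpace X]

/-- The regular open hull of the union of the slabs `t (2 i + 1 + σ) / 2 < h < 2 t (2 i + σ)` in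
`D`. -/
def slabs (D : Set X) (h : X → ℝ) (t : ℕ → ℝ) (σ : ℕ) : Set X :=
  interior (closure {x | x ∈ D ∧ ∃ i, t (2 * i + 1 + σ) / 2 < h x ∧ h x < 2 * t (2 * i + σ)})

/-- The regular open hull of the markers: the `k`-th one is the part of the component of `a k`
in which `h` is close to `t k`. -/
def markers (W D : Set X) (h : X → ℝ) (t : ℕ → ℝ) (a : ℕ → X) : Set X :=
  interior (closure {x | ∃ k, x ∈ connectedComponentIn W (a k) ∩ D ∧
    t k / 2 < h x ∧ h x < 2 * t k})

variable {D O W : Set X} {h : X → ℝ} {t : ℕ → ℝ} {a : ℕ → X}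

theorem notMem_of_mem_slabs (hO : IsOpen O) (hDO : closure D ⊆ O) (hh : ContinuousOn h O)
    {σ : ℕ} {V : Set ℝ} (hV : IsOpen V)
    (hVt : ∀ y ∈ V, ∀ i, ¬ (t (2 * i + 1 + σ) / 2 < y ∧ y < 2 * t (2 * i + σ)))
    {x : X} (hx : x ∈ slabs D h t σ) : h x ∉ V := by
  intro hxV
  have hcl := interior_subset hx
  have hxO : x ∈ O := hDO (closure_mono (fun z hz => hz.1) hcl)
  obtain ⟨z, hz, hzD, i, hi⟩ :=
    mem_closure_iff.1 hcl _ (hh.isOpen_inter_preimage hO hV) ⟨hxO, hxV⟩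
  exact hVt _ hz.2 i hi

theorem slabs_subset (hDO : closure D ⊆ O) {σ : ℕ} : slabs D h t σ ⊆ O :=
  interior_subset.trans ((closure_mono fun _ hz => hz.1).trans hDO)

/-- An open set that meets the marked part of a component meets the marker itself. -/
theorem exists_of_mem_markers {A Z : Set X} [LocallyConnectedSpace X]
    (hW : IsOpen W) (ha : ∀ k, a k ∈ W) (hA : IsComponent A W) (hZ : IsOpen Z)
    (hZA : (Z ∩ (A ∩ markers W D h t a)).Nonempty) :
    ∃ k, A = connectedComponentIn W (a k) ∧ ∃ x ∈ Z, t k / 2 < h x ∧ h x < 2 * t k := by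
  obtain ⟨x, hxZ, hxA, hx⟩ := hZA
  obtain ⟨z, ⟨hzZ, hzA⟩, k, hzk, hz⟩ :=
    mem_closure_iff.1 (interior_subset hx) _ (hZ.inter (hA.isOpen hW)) ⟨hxZ, hxA⟩
  exact ⟨k, hA.eq_of_mem (isComponent_connectedComponentIn (ha k)) hzA hzk.1, z, hzZ, hz⟩

variable (ht0 : ∀ k, 0 < t k) (ht : ∀ k, t (k + 1) < t k / 4)

include ht0 ht

theorem antitone_of_lt_div : Antitone t :=
  antitone_nat_of_succ_le fun k => by linarith [ht k, ht0 k]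

/-- Between two slabs there is a level that `slabs` does not meet. -/
theorem div_two_le_of_isPreconnected (hO : IsOpen O) (hDO : closure D ⊆ O)
    (hh : ContinuousOn h O) {σ : ℕ} {P : Set X} (hP : IsPreconnected P)
    (hPs : P ⊆ slabs D h t σ) {x y : X} (hx : x ∈ P) (hy : y ∈ P) {k l : ℕ}
    (hk : σ ≤ k) (hl : σ ≤ l) (hxk : t k / 2 < h x) (hyl : h y < 2 * t l) :
    (l - σ) / 2 ≤ (k - σ) / 2 := by
  have hanti := antitone_of_lt_div ht0 ht
  by_contra! hlt
  obtain ⟨i, hi⟩ : ∃ i, i = (k - σ) / 2 := ⟨_, rfl⟩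
  have h1 : t (2 * i + 1 + σ) ≤ t k := hanti (by omega)
  have h2 : t l ≤ t (2 * i + 1 + σ + 1) := hanti (by omega)
  have h3 := ht (2 * i + 1 + σ)
  have hgap : ∀ z ∈ Set.Ioo (2 * t (2 * i + 1 + σ + 1)) (t (2 * i + 1 + σ) / 2), ∀ j,
      ¬ (t (2 * j + 1 + σ) / 2 < z ∧ z < 2 * t (2 * j + σ)) := by
    rintro z ⟨hz1, hz2⟩ j ⟨hj1, hj2⟩
    rcases le_or_gt j i with hji | hji
    · have : t (2 * i + 1 + σ) ≤ t (2 * j + 1 + σ) := hanti (by omega)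
      linarith
    · have : t (2 * j + σ) ≤ t (2 * i + 1 + σ + 1) := hanti (by omega)
      linarith
  obtain ⟨γ, hγ⟩ := exists_between (show 2 * t (2 * i + 1 + σ + 1) < t (2 * i + 1 + σ) / 2 by
    linarith)
  obtain ⟨z, hz, rfl⟩ := hP.intermediate_value hy hx
    (hh.mono (hPs.trans (slabs_subset hDO))) (show γ ∈ Set.Icc (h y) (h x) from
      ⟨by linarith [hγ.1], by linarith [hγ.2]⟩)
  exact notMem_of_mem_slabs hO hDO hh isOpen_Ioo hgap (hPs hz) hγ

/-- No marker with a number below the shift `σ` meets a slab. -/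
theorem le_of_mem_slabs (hO : IsOpen O) (hDO : closure D ⊆ O)
    (hh : ContinuousOn h O) {σ k : ℕ} {x : X} (hx : x ∈ slabs D h t σ) (hxk : t k / 2 < h x) :
    σ ≤ k := by
  have hanti := antitone_of_lt_div ht0 ht
  by_contra! hlt
  have h1 : t σ ≤ t (k + 1) := hanti (by omega)
  refine notMem_of_mem_slabs hO hDO hh (isOpen_Ioi (a := 2 * t σ)) ?_ hx ?_
  · rintro y hy i ⟨-, hi⟩
    have : t (2 * i + σ) ≤ t σ := hanti (by omega)
    have hy : 2 * t σ < y := hy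
    linarith
  · show 2 * t σ < h x
    linarith [ht k]

variable [LocallyConnectedSpace X]

/-- The slabs join the components of `a (2 i + σ)` and `a (2 i + 1 + σ)`, and no others. -/
theorem areJoined_slabs_iff (hW : IsOpen W) (hO : IsOpen O) (hD : IsOpen D) (hDO : closure D ⊆ O)
    (hh : ContinuousOn h O)
    (hconn : ∀ α β, IsPreconnected {x | x ∈ D ∧ α < h x ∧ h x < β})
    (haD : ∀ k, a k ∈ D) (hat : ∀ k, h (a k) = t k) (haW : ∀ k, a k ∈ W)
    (hinj : ∀ k l, connectedComponentIn W (a k) = connectedComponentIn W (a l) → k = l)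
    {σ k l : ℕ} :
    AreJoined (markers W D h t a) (slabs D h t σ) (connectedComponentIn W (a k))
      (connectedComponentIn W (a l)) ↔
        k ≠ l ∧ σ ≤ k ∧ σ ≤ l ∧ (k - σ) / 2 = (l - σ) / 2 := by
  have hanti := antitone_of_lt_div ht0 ht
  have hcomp := fun k => isComponent_connectedComponentIn (haW k)
  have hDh : ∀ α β, IsOpen {x | x ∈ D ∧ α < h x ∧ h x < β} := fun α β =>
    (hh.mono (subset_closure.trans hDO)).isOpen_inter_preimage hD (isOpen_Ioo (a := α) (b := β))
  constructor
  · rintro ⟨hne, P, hP, hPk, hPl⟩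
    have hPo : IsOpen P := hP.isOpen isOpen_interior
    obtain ⟨k', hk', x, hx, hx1, hx2⟩ := exists_of_mem_markers hW haW (hcomp k) hPo hPk
    obtain ⟨l', hl', y, hy, hy1, hy2⟩ := exists_of_mem_markers hW haW (hcomp l) hPo hPl
    obtain rfl := hinj _ _ hk'
    obtain rfl := hinj _ _ hl'
    have hk := le_of_mem_slabs ht0 ht hO hDO hh (hP.subset hx) hx1
    have hl := le_of_mem_slabs ht0 ht hO hDO hh (hP.subset hy) hy1
    refine ⟨fun h' => hne (h' ▸ rfl), hk, hl, le_antisymm ?_ ?_⟩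
    · exact div_two_le_of_isPreconnected ht0 ht hO hDO hh hP.isConnected.isPreconnected hP.subset
        hy hx hl hk hy1 hx2
    · exact div_two_le_of_isPreconnected ht0 ht hO hDO hh hP.isConnected.isPreconnected hP.subset
        hx hy hk hl hx1 hy2
  · rintro ⟨hne, hk, hl, hkl⟩
    obtain ⟨i, hi⟩ : ∃ i, i = (k - σ) / 2 := ⟨_, rfl⟩
    have hsub : {x | x ∈ D ∧ t (2 * i + 1 + σ) / 2 < h x ∧ h x < 2 * t (2 * i + σ)} ⊆
        slabs D h t σ := by
      refine interior_maximal ?_ (hDh _ _)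
      exact fun x hx => subset_closure ⟨hx.1, i, hx.2⟩
    have hmem : ∀ m, σ ≤ m → i = (m - σ) / 2 →
        a m ∈ {x | x ∈ D ∧ t (2 * i + 1 + σ) / 2 < h x ∧ h x < 2 * t (2 * i + σ)} := by
      intro m hm him
      have h1 : t (2 * i + 1 + σ) ≤ t m := hanti (by omega)
      have h2 : t m ≤ t (2 * i + σ) := hanti (by omega)
      exact ⟨haD m, by rw [hat]; linarith [ht0 (2 * i + 1 + σ)], by rw [hat]; linarith [ht0 m]⟩
    have hmark : ∀ m, a m ∈ connectedComponentIn W (a m) ∩ markers W D h t a := by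
      intro m
      refine ⟨mem_connectedComponentIn (haW m), mem_interior.2 ⟨_, ?_,
        ((hcomp m).isOpen hW).inter (hDh (t m / 2) (2 * t m)), mem_connectedComponentIn (haW m),
        haD m, by rw [hat]; linarith [ht0 m], by rw [hat]; linarith [ht0 m]⟩⟩
      exact fun x hx => subset_closure ⟨m, ⟨hx.1, hx.2.1⟩, hx.2.2⟩
    have hPcomp := isComponent_connectedComponentIn (hsub (hmem k hk hi))
    refine ⟨fun h' => hne (hinj _ _ h'), _, hPcomp,
      ⟨a k, mem_connectedComponentIn (hsub (hmem k hk hi)), hmark k⟩, ⟨a l, ?_, hmark l⟩⟩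
    exact (hconn _ _).subset_connectedComponentIn (hmem k hk hi) hsub (hmem l hl (hi.trans hkl))

/-- Even slabs give a perfect matching, odd slabs one that misses the first component. -/
theorem hasMatchings_slabs (hW : IsOpen W) (hO : IsOpen O) (hD : IsOpen D) (hDO : closure D ⊆ O)
    (hh : ContinuousOn h O)
    (hconn : ∀ α β, IsPreconnected {x | x ∈ D ∧ α < h x ∧ h x < β})
    (haD : ∀ k, a k ∈ D) (hat : ∀ k, h (a k) = t k) (haW : ∀ k, a k ∈ W)
    (hinj : ∀ k l, connectedComponentIn W (a k) = connectedComponentIn W (a l) → k = l) :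
    HasMatchings W (markers W D h t a) (slabs D h t 0) (slabs D h t 1) := by
  have hjoin := fun σ k l => areJoined_slabs_iff ht0 ht hW hO hD hDO hh hconn haD hat haW hinj
    (σ := σ) (k := k) (l := l)
  have hnode : ∀ A, IsNode W (markers W D h t a) A → ∃ k, A = connectedComponentIn W (a k) := by
    rintro A ⟨hA, hAU⟩
    obtain ⟨k, hk, -⟩ := exists_of_mem_markers hW haW hA isOpen_univ (by rwa [Set.univ_inter])
    exact ⟨k, hk⟩
  have hnode' : ∀ k, IsNode W (markers W D h t a) (connectedComponentIn W (a k)) := by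
    intro k
    refine ⟨isComponent_connectedComponentIn (haW k), ?_⟩
    obtain ⟨l, hkl⟩ : ∃ l, k ≠ l ∧ k / 2 = l / 2 := by
      rcases Nat.even_or_odd' k with ⟨i, rfl | rfl⟩
      · exact ⟨2 * i + 1, by omega⟩
      · exact ⟨2 * i, by omega⟩
    obtain ⟨-, P, -, ⟨x, -, hx⟩, -⟩ := (hjoin 0 k l).2 ⟨hkl.1, by omega, by omega, hkl.2⟩
    exact ⟨x, hx⟩
  have huniq : ∀ σ k, σ ≤ k → ∃! B, IsNode W (markers W D h t a) B ∧
      AreJoined (markers W D h t a) (slabs D h t σ) (connectedComponentIn W (a k)) B := by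
    intro σ k hσ
    obtain ⟨l, hl⟩ : ∃ l, k ≠ l ∧ σ ≤ l ∧ (k - σ) / 2 = (l - σ) / 2 := by
      rcases Nat.even_or_odd' (k - σ) with ⟨i, hi | hi⟩
      · exact ⟨k + 1, by omega⟩
      · exact ⟨k - 1, by omega⟩
    refine ⟨_, ⟨hnode' l, (hjoin σ k l).2 ⟨hl.1, hσ, hl.2⟩⟩, ?_⟩
    rintro B ⟨hB, hkB⟩
    obtain ⟨m, rfl⟩ := hnode B hB
    have := (hjoin σ k m).1 hkB
    have : m = l := by omega
    rw [this]
  refine ⟨fun A hA => ?_, _, hnode' 0, fun B hB h0 => ?_, fun A hA hA0 => ?_⟩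
  · obtain ⟨k, rfl⟩ := hnode A hA
    exact huniq 0 k k.zero_le
  · obtain ⟨m, rfl⟩ := hnode B hB
    have := (hjoin 1 0 m).1 h0
    omega
  · obtain ⟨k, rfl⟩ := hnode A hA
    refine huniq 1 k (Nat.one_le_iff_ne_zero.2 ?_)
    rintro rfl
    exact hA0 rfl

end Slabs

/-! ### Infinitely many components accumulate -/

section Accumulation

open Topology

variable {n : ℕ} {M : Type*} [TopologicalSpace M]

/-- A chart and a coordinate direction that see infinitely many points of a set accumulating
at `p` on the positive side. -/
theorem exists_coordinate_frequently_pos {A : Set M} {p : M}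
    (hp : AccPt p (Filter.principal A))
    (e : OpenPartialHomeomorph M (EuclideanSpace ℝ (Fin n))) (hpe : p ∈ e.source) :
    ∃ ℓ : EuclideanSpace ℝ (Fin n) →L[ℝ] ℝ, ∃ᶠ x in 𝓝 p, x ∈ A ∧ ℓ (e p) < ℓ (e x) := by
  by_contra hno
  simp only [not_exists, Filter.not_frequently] at hno
  have h1 : ∀ᶠ x in 𝓝 p, ∀ i : Fin n, ¬ (x ∈ A ∧ (e p) i < (e x) i) :=
    Filter.eventually_all.2 fun i => hno (EuclideanSpace.proj i)
  have h2 : ∀ᶠ x in 𝓝 p, ∀ i : Fin n, ¬ (x ∈ A ∧ (e x) i < (e p) i) :=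
    Filter.eventually_all.2 fun i => (hno (-EuclideanSpace.proj i)).mono fun x hx h' => hx (by
      simpa using h')
  obtain ⟨x, ⟨hxp, hxA⟩, hx1, hx2, hxe⟩ := ((accPt_iff_frequently.1 hp).and_eventually
    (h1.and (h2.and (e.open_source.mem_nhds hpe)))).exists
  refine hxp (e.injOn hxe hpe ?_)
  ext i
  exact le_antisymm (not_lt.1 fun h => hx1 i ⟨hxA, h⟩) (not_lt.1 fun h => hx2 i ⟨hxA, h⟩)

/-- A small ball in a chart has its closure in the chart domain. -/
theorem closure_chart_ball_subset [T2Space M] {E : Type*} [NormedAddCommGroup E] [ProperSpace E]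
    (e : OpenPartialHomeomorph M E) {c : E} {r : ℝ} (hr : Metric.closedBall c r ⊆ e.target) :
    closure (e.symm '' Metric.ball c r) ⊆ e.symm '' Metric.closedBall c r :=
  closure_minimal (Set.image_mono Metric.ball_subset_closedBall)
    (((isCompact_closedBall c r).image_of_continuousOn
      (e.continuousOn_symm.mono hr)).isClosed)

theorem exists_closedBall_subset_target {E : Type*} [NormedAddCommGroup E]
    (e : OpenPartialHomeomorph M E) {p : M} (hp : p ∈ e.source) :
    ∃ r > 0, Metric.closedBall (e p) r ⊆ e.target :=
  Metric.nhds_basis_closedBall.mem_iff.1 (e.open_target.mem_nhds (e.map_source hp))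

/-- The components accumulate somewhere, and a sequence of points in different components can be
chosen on which a coordinate decreases geometrically to its value at the accumulation point. -/
theorem exists_hasMatchings (n : ℕ) {M : Type*} [TopologicalSpace M] [T2Space M] [CompactSpace M]
    [ChartedSpace (EuclideanSpace ℝ (Fin n)) M] [LocallyConnectedSpace M] {W : Set M}
    (hW : IsOpen W) (hinf : {C | IsComponent C W}.Infinite) :
    ∃ U R S : Set M, IsRegularOpen U ∧ IsRegularOpen R ∧ IsRegularOpen S ∧
      HasMatchings W U R S := by
  have : Infinite {C | IsComponent C W} := hinf.to_subtype
  choose b hbW hb using fun C : {C | IsComponent C W} => C.2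
  have hbinj : Function.Injective b := fun C D h => Subtype.ext (by rw [hb C, hb D, h])
  obtain ⟨p, -, hp⟩ := (Set.infinite_range_of_injective hbinj).exists_accPt_of_subset_isCompact
    isCompact_univ (Set.subset_univ _)
  let e := chartAt (EuclideanSpace ℝ (Fin n)) p
  have hpe : p ∈ e.source := mem_chart_source _ p
  obtain ⟨ℓ, hℓ⟩ := exists_coordinate_frequently_pos hp e hpe
  obtain ⟨r, hr, hre⟩ := exists_closedBall_subset_target e hpe
  let D : Set M := e.symm '' Metric.ball (e p) r
  have hDe : Metric.ball (e p) r ⊆ e.target := Metric.ball_subset_closedBall.trans hre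
  have hD : IsOpen D := e.isOpen_image_symm_of_subset_target Metric.isOpen_ball hDe
  have hpD : p ∈ D := ⟨e p, Metric.mem_ball_self hr, e.left_inv hpe⟩
  have hDO : closure D ⊆ e.source := by
    refine (closure_chart_ball_subset e hre).trans ?_
    rintro _ ⟨y, hy, rfl⟩
    exact e.map_target (hre hy)
  let h : M → ℝ := fun x => ℓ (e x) - ℓ (e p)
  have hh : ContinuousOn h e.source :=
    (ℓ.continuous.comp_continuousOn e.continuousOn).sub continuousOn_const
  have hstep : ∀ ε > 0, ∃ C, b C ∈ D ∧ 0 < h (b C) ∧ h (b C) < ε := by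
    intro ε hε
    have hcont : ContinuousAt h p := hh.continuousAt (e.open_source.mem_nhds hpe)
    have hlt : ∀ᶠ x in 𝓝 p, h x < ε := hcont.eventually_lt_const (by simpa [h] using hε)
    obtain ⟨x, ⟨⟨C, rfl⟩, hx0⟩, hxε, hxD⟩ :=
      (hℓ.and_eventually (hlt.and (hD.mem_nhds hpD))).exists
    exact ⟨C, hxD, sub_pos.2 hx0, hxε⟩
  choose next hnextD hnext0 hnext using hstep
  let F : {C // b C ∈ D ∧ 0 < h (b C)} → {C // b C ∈ D ∧ 0 < h (b C)} := fun C =>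
    ⟨next (h (b C.1) / 4) (by linarith [C.2.2]), hnextD _ _, hnext0 _ _⟩
  let c : ℕ → {C // b C ∈ D ∧ 0 < h (b C)} := fun k =>
    F^[k] ⟨next 1 one_pos, hnextD _ _, hnext0 _ _⟩
  have hc : ∀ k, h (b (c (k + 1)).1) < h (b (c k).1) / 4 := by
    intro k
    have : c (k + 1) = F (c k) := Function.iterate_succ_apply' F k _
    rw [this]
    exact hnext _ _
  have hanti : StrictAnti fun k => h (b (c k).1) := strictAnti_nat_of_succ_lt fun k => by
    linarith [hc k, (c k).2.2]
  refine ⟨_, _, _, isRegularOpen_interior_of_isClosed isClosed_closure,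
    isRegularOpen_interior_of_isClosed isClosed_closure,
    isRegularOpen_interior_of_isClosed isClosed_closure,
    hasMatchings_slabs (a := fun k => b (c k).1) (h := h) (D := D) (t := fun k => h (b (c k).1))
      (fun k => (c k).2.2) hc hW e.open_source hD hDO hh (fun α β => ?_) (fun k => (c k).2.1)
      (fun k => rfl) (fun k => hbW _) fun k l hkl => ?_⟩
  · have : {x | x ∈ D ∧ α < h x ∧ h x < β} = e.symm ''
        (Metric.ball (e p) r ∩ ℓ ⁻¹' Set.Ioo (α + ℓ (e p)) (β + ℓ (e p))) := by
      ext x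
      constructor
      · rintro ⟨⟨y, hy, rfl⟩, h1, h2⟩
        simp only [h, e.right_inv (hDe hy)] at h1 h2
        exact ⟨y, ⟨hy, by linarith, by linarith⟩, rfl⟩
      · rintro ⟨y, ⟨hy, h1, h2⟩, rfl⟩
        refine ⟨⟨y, hy, rfl⟩, ?_⟩
        simp only [h, e.right_inv (hDe hy)]
        exact ⟨by linarith, by linarith⟩
    rw [this]
    refine IsPreconnected.image ?_ _ (e.continuousOn_symm.mono (Set.inter_subset_left.trans hDe))
    exact ((convex_ball _ _).inter
      ((convex_Ioo _ _).linear_preimage ℓ.toLinearMap)).isPreconnected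
  · refine hanti.injective ?_
    have : (c k).1 = (c l).1 := Subtype.ext (by rw [hb, hb (c l).1]; exact hkl)
    simp only [this]

end Accumulation

/-! ### Realizing regular open sets from local data -/

section LocalData

open Topology

variable {G X : Type*} [Group G] [MulAction G X] [TopologicalSpace X]

variable (G X) in
/-- Every small open set is the support of a group element, up to a nowhere dense set. -/
def LocallyDense : Prop :=
  ∀ p : X, ∃ N ∈ 𝓝 p, ∀ V : Set X, IsOpen V → V ⊆ N →
    ∃ g : G, (∀ z ∉ V, g • z = z) ∧ V ⊆ closure {x | g • x ≠ x}

/-- The space is covered by finitely many sets as in `LocallyDense`; these are treated one after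
the other, and each new factor is supported off the closure of the support of the product of the
previous ones. -/
theorem LocallyDense.realizesRegularOpen [CompactSpace X] (h : LocallyDense G X) :
    RealizesRegularOpen G X := by
  classical
  intro W hW
  choose N hN hdense using h
  have key : ∀ s : Finset X, ∃ g : G, (∀ z ∉ W, g • z = z) ∧
      ∀ p ∈ s, W ∩ interior (N p) ⊆ closure {x | g • x ≠ x} := by
    intro s
    induction s using Finset.induction_on with
    | empty => exact ⟨1, fun z _ => one_smul G z, by simp⟩
    | insert p s _ ih =>
      obtain ⟨g, hgW, hg⟩ := ih
      obtain ⟨k, hkV, hk⟩ := hdense p ((W ∩ interior (N p)) \ closure {x | g • x ≠ x})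
        ((hW.isOpen.inter isOpen_interior).sdiff isClosed_closure)
        fun z hz => interior_subset hz.1.2
      have hsub1 : {x | g • x ≠ x} ⊆ {x : X | (k * g) • x ≠ x} := by
        intro x hx
        have hgx : g • g • x ≠ g • x := fun h' => hx (smul_left_cancel g h')
        show (k * g) • x ≠ x
        rw [mul_smul, hkV _ fun h' => h'.2 (subset_closure hgx)]
        exact hx
      have hsub2 : {x | k • x ≠ x} ⊆ {x : X | (k * g) • x ≠ x} := by
        intro x hx
        have hgx : g • x = x := by
          by_contra h'
          exact hx (hkV x fun h'' => h''.2 (subset_closure h'))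
        show (k * g) • x ≠ x
        rw [mul_smul, hgx]
        exact hx
      refine ⟨k * g, fun z hz => ?_, fun q hq => ?_⟩
      · rw [mul_smul, hgW z hz, hkV z fun h' => hz h'.1.1]
      · rcases Finset.mem_insert.1 hq with rfl | hq
        · intro x hx
          by_cases hxg : x ∈ closure {x | g • x ≠ x}
          · exact closure_mono hsub1 hxg
          · exact closure_mono hsub2 (hk ⟨hx, hxg⟩)
        · exact (hg q hq).trans (closure_mono hsub1)
  obtain ⟨s, -, hs⟩ := isCompact_univ.elim_nhds_subcover (fun p => interior (N p)) fun p _ =>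
    interior_mem_nhds.2 (hN p)
  obtain ⟨g, hgW, hg⟩ := key s
  have hsub : W ⊆ closure {x | g • x ≠ x} := by
    intro x hx
    obtain ⟨p, hp, hxp⟩ := Set.mem_iUnion₂.1 (hs (Set.mem_univ x))
    exact hg p hp ⟨hx, hxp⟩
  exact ⟨g, (extSupp_subset_of_fixed_off hW hgW).antisymm (interior_maximal hsub hW.isOpen)⟩

end LocalData

/-! ### Extending isotopies from a chart to the manifold -/

section Extension

open Topology

variable {n : ℕ}

/-- A smooth isotopy of `ℝⁿ` that starts at the identity and is supported in `V`. -/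
structure IsEuclIsotopy (F : ℝ → (EuclideanSpace ℝ (Fin n) ≃ₜ EuclideanSpace ℝ (Fin n)))
    (V : Set (EuclideanSpace ℝ (Fin n))) : Prop where
  zero : F 0 = 1
  contDiff : ContDiff ℝ ∞ fun p : ℝ × EuclideanSpace ℝ (Fin n) => F p.1 p.2
  contDiff_symm : ∀ t, ContDiff ℝ ∞ (F t).symm
  fixed : ∀ t, ∀ y ∉ V, F t y = y

variable {M : Type*} [TopologicalSpace M]

open Classical in
/-- The map that is `f` in the chart `e` and the identity off the chart domain. -/
noncomputable def chartExtend {E : Type*} [TopologicalSpace E] (e : OpenPartialHomeomorph M E)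
    (f : E → E) (x : M) : M :=
  if x ∈ e.source then e.symm (f (e x)) else x

theorem chartExtend_of_mem {E : Type*} [TopologicalSpace E] (e : OpenPartialHomeomorph M E)
    (f : E → E) {x : M} (hx : x ∈ e.source) : chartExtend e f x = e.symm (f (e x)) :=
  if_pos hx

theorem chartExtend_of_notMem {E : Type*} [TopologicalSpace E] (e : OpenPartialHomeomorph M E)
    (f : E → E) {x : M} (hx : x ∉ e.source) : chartExtend e f x = x :=
  if_neg hx

theorem chartExtend_comp {E : Type*} [TopologicalSpace E] (e : OpenPartialHomeomorph M E)
    {f g : E → E} (hg : Set.MapsTo g e.target e.target) (hfg : Function.LeftInverse f g) (x : M) :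
    chartExtend e f (chartExtend e g x) = x := by
  by_cases hx : x ∈ e.source
  · have h1 := hg (e.map_source hx)
    rw [chartExtend_of_mem e g hx, chartExtend_of_mem e f (e.map_target h1), e.right_inv h1,
      hfg, e.left_inv hx]
  · rw [chartExtend_of_notMem e g hx, chartExtend_of_notMem e f hx]

/-- A bijection that is the identity off `V` maps any set that contains `V` to itself. -/
theorem mapsTo_of_fixed_off {E : Type*} {f : E → E} (hf : Function.Injective f) {V S : Set E}
    (hfix : ∀ y ∉ V, f y = y) (hV : V ⊆ S) : Set.MapsTo f S S := by
  intro y hy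
  by_contra h
  exact h (by rwa [hf (hfix _ fun h' => h (hV h'))])

theorem symm_fixed_off {E : Type*} (f : E ≃ E) {V : Set E} (hfix : ∀ y ∉ V, f y = y) :
    ∀ y ∉ V, f.symm y = y := fun y hy => f.symm_apply_eq.2 (hfix y hy).symm

/-- In the chart `e` the measure `μ` is Lebesgue measure. -/
def IsVolumeChart [MeasurableSpace M] (μ : Measure M)
    (e : OpenPartialHomeomorph M (EuclideanSpace ℝ (Fin n))) : Prop :=
  ∀ A : Set M, MeasurableSet A → A ⊆ e.source → μ A = volume (e '' A)

theorem IsVolumeChart.measurePreserving [MeasurableSpace M] [BorelSpace M] {μ : Measure M}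
    {e : OpenPartialHomeomorph M (EuclideanSpace ℝ (Fin n))} (he : IsVolumeChart μ e)
    {f : EuclideanSpace ℝ (Fin n) ≃ₜ EuclideanSpace ℝ (Fin n)}
    (hf : MeasurePreserving f volume volume) (hmaps : Set.MapsTo f e.target e.target)
    (hmaps' : Set.MapsTo f.symm e.target e.target) {g : M ≃ₜ M}
    (hg : ∀ x, g x = chartExtend e f x) : MeasurePreserving g μ μ := by
  refine ⟨g.continuous.measurable, Measure.ext fun A hA => ?_⟩
  have hS := e.open_source.measurableSet
  rw [Measure.map_apply g.continuous.measurable hA, ← measure_inter_add_sdiff _ hS,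
    ← measure_inter_add_sdiff A hS]
  have h1 : g ⁻¹' A \ e.source = A \ e.source := by
    ext x
    refine and_congr_left fun hx => ?_
    rw [Set.mem_preimage, hg, chartExtend_of_notMem e f hx]
  have h2 : e '' (g ⁻¹' A ∩ e.source) = f ⁻¹' (e '' (A ∩ e.source)) := by
    ext y
    constructor
    · rintro ⟨x, ⟨hxA, hx⟩, rfl⟩
      have hfx := hmaps (e.map_source hx)
      rw [Set.mem_preimage, hg, chartExtend_of_mem e f hx] at hxA
      exact ⟨_, ⟨hxA, e.map_target hfx⟩, e.right_inv hfx⟩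
    · rintro ⟨x, ⟨hxA, hx⟩, hxy⟩
      have hy : y ∈ e.target := by
        have := hmaps' (e.map_source hx)
        rwa [hxy, f.symm_apply_apply] at this
      refine ⟨e.symm y, ⟨?_, e.map_target hy⟩, e.right_inv hy⟩
      rw [Set.mem_preimage, hg, chartExtend_of_mem e f (e.map_target hy), e.right_inv hy, ← hxy,
        e.left_inv hx]
      exact hxA
  rw [h1, he _ ((g.continuous.measurable hA).inter hS) Set.inter_subset_right,
    he _ (hA.inter hS) Set.inter_subset_right, h2, hf.measure_preimage_emb f.measurableEmbedding]

variable [ChartedSpace (EuclideanSpace ℝ (Fin n)) M]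

/-- The partial homeomorphism `e` to `ℝⁿ` is a smooth chart. -/
def IsSmoothChart (e : OpenPartialHomeomorph M (EuclideanSpace ℝ (Fin n))) : Prop :=
  ContMDiffOn (𝓡 n) (𝓡 n) ∞ e e.source ∧ ContMDiffOn (𝓡 n) (𝓡 n) ∞ e.symm e.target

/-- Outside the chart domain the extension is smooth because it is the identity off the compact,
hence closed, preimage of `K`. -/
theorem contMDiff_chartExtend [T2Space M]
    {e : OpenPartialHomeomorph M (EuclideanSpace ℝ (Fin n))} (he : IsSmoothChart e)
    {Φ : ℝ → EuclideanSpace ℝ (Fin n) → EuclideanSpace ℝ (Fin n)}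
    (hΦ : ContDiff ℝ ∞ fun p : ℝ × EuclideanSpace ℝ (Fin n) => Φ p.1 p.2)
    {K : Set (EuclideanSpace ℝ (Fin n))} (hK : IsCompact K) (hKe : K ⊆ e.target)
    (hfix : ∀ t, ∀ y ∉ K, Φ t y = y) (hmaps : ∀ t, Set.MapsTo (Φ t) e.target e.target) :
    ContMDiff (𝓘(ℝ, ℝ).prod (𝓡 n)) (𝓡 n) ∞ fun p : ℝ × M => chartExtend e (Φ p.1) p.2 := by
  have hcl : IsClosed (e.symm '' K) :=
    (hK.image_of_continuousOn (e.continuousOn_symm.mono hKe)).isClosed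
  intro p
  by_cases hp : p.2 ∈ e.source
  · have hS : IsOpen {q : ℝ × M | q.2 ∈ e.source} := e.open_source.preimage continuous_snd
    have h1 : ContMDiffOn (𝓘(ℝ, ℝ).prod (𝓡 n)) (𝓡 n) ∞ (fun q : ℝ × M => e q.2)
        {q : ℝ × M | q.2 ∈ e.source} :=
      he.1.comp contMDiff_snd.contMDiffOn fun q hq => hq
    have h2 : ContMDiffOn (𝓘(ℝ, ℝ).prod (𝓡 n)) 𝓘(ℝ, ℝ × EuclideanSpace ℝ (Fin n)) ∞
        (fun q : ℝ × M => (q.1, e q.2)) {q : ℝ × M | q.2 ∈ e.source} :=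
      contMDiff_fst.contMDiffOn.prodMk_space h1
    have h3 : ContMDiffOn (𝓘(ℝ, ℝ).prod (𝓡 n)) (𝓡 n) ∞ (fun q : ℝ × M => Φ q.1 (e q.2))
        {q : ℝ × M | q.2 ∈ e.source} :=
      hΦ.contMDiff.comp_contMDiffOn h2
    have h4 : ContMDiffOn (𝓘(ℝ, ℝ).prod (𝓡 n)) (𝓡 n) ∞
        (fun q : ℝ × M => e.symm (Φ q.1 (e q.2))) {q : ℝ × M | q.2 ∈ e.source} :=
      he.2.comp h3 fun q hq => hmaps q.1 (e.map_source hq)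
    exact (h4.contMDiffAt (hS.mem_nhds hp)).congr_of_eventuallyEq
      (Filter.eventually_of_mem (hS.mem_nhds hp) fun q hq => chartExtend_of_mem e _ hq)
  · have hp' : p ∈ {q : ℝ × M | q.2 ∈ (e.symm '' K)ᶜ} := by
      rintro ⟨y, hy, hyp⟩
      exact hp (hyp ▸ e.map_target (hKe hy))
    have hO : IsOpen {q : ℝ × M | q.2 ∈ (e.symm '' K)ᶜ} :=
      hcl.isOpen_compl.preimage continuous_snd
    refine contMDiffAt_snd.congr_of_eventuallyEq
      (Filter.eventually_of_mem (hO.mem_nhds hp') fun q hq => ?_)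
    by_cases hqe : q.2 ∈ e.source
    · show chartExtend e (Φ q.1) q.2 = q.2
      rw [chartExtend_of_mem e _ hqe, hfix _ _ fun h => hq ⟨_, h, e.left_inv hqe⟩,
        e.left_inv hqe]
    · exact chartExtend_of_notMem e _ hqe

theorem contMDiff_chartExtend_of_contDiff [T2Space M]
    {e : OpenPartialHomeomorph M (EuclideanSpace ℝ (Fin n))} (he : IsSmoothChart e)
    {f : EuclideanSpace ℝ (Fin n) → EuclideanSpace ℝ (Fin n)}
    (hf : ContDiff ℝ ∞ f) {K : Set (EuclideanSpace ℝ (Fin n))} (hK : IsCompact K)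
    (hKe : K ⊆ e.target) (hfix : ∀ y ∉ K, f y = y) (hmaps : Set.MapsTo f e.target e.target) :
    ContMDiff (𝓡 n) (𝓡 n) ∞ (chartExtend e f) :=
  (contMDiff_chartExtend he (Φ := fun _ => f) (hf.comp contDiff_snd) hK hKe (fun _ => hfix)
    fun _ => hmaps).comp (contMDiff_const.prodMk contMDiff_id : ContMDiff (𝓡 n)
      (𝓘(ℝ, ℝ).prod (𝓡 n)) ∞ fun x : M => ((0 : ℝ), x))

/-- An isotopy of `ℝⁿ` with compact support in the range of a chart gives an isotopy of the
manifold. -/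
theorem IsEuclIsotopy.exists_isSmoothIsotopy [T2Space M]
    {e : OpenPartialHomeomorph M (EuclideanSpace ℝ (Fin n))} (he : IsSmoothChart e)
    {F : ℝ → (EuclideanSpace ℝ (Fin n) ≃ₜ EuclideanSpace ℝ (Fin n))}
    {V K : Set (EuclideanSpace ℝ (Fin n))} (hF : IsEuclIsotopy F V) (hVK : V ⊆ K)
    (hK : IsCompact K) (hKe : K ⊆ e.target) :
    ∃ F' : ℝ → (M ≃ₜ M), IsSmoothIsotopy n F' ∧ ∀ t x, F' t x = chartExtend e (F t) x := by
  have hfix : ∀ t, ∀ y ∉ K, F t y = y := fun t y hy => hF.fixed t y fun h => hy (hVK h)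
  have hfix' : ∀ t, ∀ y ∉ K, (F t).symm y = y := fun t => symm_fixed_off (F t).toEquiv (hfix t)
  have hmaps : ∀ t, Set.MapsTo (F t) e.target e.target := fun t =>
    mapsTo_of_fixed_off (F t).injective (hfix t) hKe
  have hmaps' : ∀ t, Set.MapsTo (F t).symm e.target e.target := fun t =>
    mapsTo_of_fixed_off (F t).symm.injective (hfix' t) hKe
  have hsm : ∀ t, ContMDiff (𝓡 n) (𝓡 n) ∞ (chartExtend e (F t)) := fun t =>
    contMDiff_chartExtend_of_contDiff he
      (hF.contDiff.comp (contDiff_const.prodMk contDiff_id : ContDiff ℝ ∞ fun y => (t, y)))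
      hK hKe (hfix t) (hmaps t)
  have hsm' : ∀ t, ContMDiff (𝓡 n) (𝓡 n) ∞ (chartExtend e (F t).symm) := fun t =>
    contMDiff_chartExtend_of_contDiff he (hF.contDiff_symm t) hK hKe (hfix' t) (hmaps' t)
  refine ⟨fun t =>
    { toFun := chartExtend e (F t)
      invFun := chartExtend e (F t).symm
      left_inv := chartExtend_comp e (hmaps t) (F t).left_inv
      right_inv := chartExtend_comp e (hmaps' t) (F t).right_inv
      continuous_toFun := (hsm t).continuous
      continuous_invFun := (hsm' t).continuous }, ⟨?_, fun t => ⟨hsm t, hsm' t⟩,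
      contMDiff_chartExtend he hF.contDiff hK hKe hfix hmaps⟩, fun t x => rfl⟩
  ext x
  show chartExtend e (F 0) x = x
  rw [hF.zero]
  by_cases hx : x ∈ e.source
  · rw [chartExtend_of_mem e _ hx]
    exact e.left_inv hx
  · exact chartExtend_of_notMem e _ hx

end Extension

/-! ### From `ℝⁿ` to the manifold -/

section Transfer

open Topology

instance (X : Type*) [TopologicalSpace X] : MulAction (X ≃ₜ X) X where
  smul f x := f x
  one_smul _ := rfl
  mul_smul _ _ _ := rfl

instance (X : Type*) [TopologicalSpace X] (G : Subgroup (X ≃ₜ X)) : ContinuousConstSMul G X where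
  continuous_const_smul g := (g : X ≃ₜ X).continuous

instance (X : Type*) [TopologicalSpace X] (G : Subgroup (X ≃ₜ X)) : FaithfulSMul G X where
  eq_of_smul_eq_smul h := Subtype.ext (Homeomorph.ext h)

variable {n : ℕ}

/-- Isotopies through maps with the property `P` move points densely in any bounded open set. -/
def EuclDense (P : (EuclideanSpace ℝ (Fin n) ≃ₜ EuclideanSpace ℝ (Fin n)) → Prop) : Prop :=
  ∀ V : Set (EuclideanSpace ℝ (Fin n)), IsOpen V → Bornology.IsBounded V →
    ∃ F, IsEuclIsotopy F V ∧ (∀ t, P (F t)) ∧ V ⊆ closure {y | F 1 y ≠ y}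

/-- Isotopies through maps with the property `P` and with small support carry nearby points to each
other. -/
def EuclMixing (P : (EuclideanSpace ℝ (Fin n) ≃ₜ EuclideanSpace ℝ (Fin n)) → Prop) : Prop :=
  ∀ c : EuclideanSpace ℝ (Fin n), ∀ r > 0, ∃ δ > 0, ∀ x ∈ Metric.ball c δ, ∀ y ∈ Metric.ball c δ,
    ∃ F, IsEuclIsotopy F (Metric.ball c r) ∧ (∀ t, P (F t)) ∧ F 1 x = y

variable {M : Type*} [TopologicalSpace M]

/-- The group contains the time-one maps of the isotopies through maps with the property `P` in
suitable charts. -/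
def ContainsChartIsotopies
    (P : (EuclideanSpace ℝ (Fin n) ≃ₜ EuclideanSpace ℝ (Fin n)) → Prop)
    (G : Subgroup (M ≃ₜ M)) : Prop :=
  ∀ p : M, ∃ e : OpenPartialHomeomorph M (EuclideanSpace ℝ (Fin n)), p ∈ e.source ∧
    ∀ F V K, IsEuclIsotopy F V → (∀ t, P (F t)) → V ⊆ K → IsCompact K → K ⊆ e.target →
      ∃ g : G, ∀ x : M, g • x = chartExtend e (F 1) x

variable {P : (EuclideanSpace ℝ (Fin n) ≃ₜ EuclideanSpace ℝ (Fin n)) → Prop}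
  {G : Subgroup (M ≃ₜ M)}

theorem ContainsChartIsotopies.locallyDense (hG : ContainsChartIsotopies P G)
    (hP : EuclDense P) : LocallyDense G M := by
  intro p
  obtain ⟨e, hpe, he⟩ := hG p
  obtain ⟨r, hr, hre⟩ := exists_closedBall_subset_target e hpe
  have hball : Metric.ball (e p) r ⊆ e.target := Metric.ball_subset_closedBall.trans hre
  refine ⟨e.symm '' Metric.ball (e p) r,
    (e.isOpen_image_symm_of_subset_target Metric.isOpen_ball hball).mem_nhds
      ⟨e p, Metric.mem_ball_self hr, e.left_inv hpe⟩, fun V hV hVN => ?_⟩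
  have hVe : V ⊆ e.source := by
    intro x hx
    obtain ⟨y, hy, rfl⟩ := hVN hx
    exact e.map_target (hball hy)
  have hVb : e '' V ⊆ Metric.ball (e p) r := by
    rintro _ ⟨x, hx, rfl⟩
    obtain ⟨y, hy, rfl⟩ := hVN hx
    rwa [e.right_inv (hball hy)]
  obtain ⟨F, hF, hPF, hd⟩ := hP (e '' V) (e.isOpen_image_of_subset_source hV hVe)
    (Metric.isBounded_ball.subset hVb)
  obtain ⟨g, hg⟩ := he F _ _ hF hPF (hVb.trans Metric.ball_subset_closedBall)
    (isCompact_closedBall (e p) r) hre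
  have hmaps : Set.MapsTo (F 1) e.target e.target :=
    mapsTo_of_fixed_off (F 1).injective (hF.fixed 1) (hVb.trans hball)
  refine ⟨g, fun z hz => ?_, fun x hx => mem_closure_iff.2 fun Z hZ hxZ => ?_⟩
  · rw [hg]
    by_cases hze : z ∈ e.source
    · rw [chartExtend_of_mem e _ hze, hF.fixed 1, e.left_inv hze]
      rintro ⟨w, hw, hwz⟩
      exact hz (e.injOn (hVe hw) hze hwz ▸ hw)
    · exact chartExtend_of_notMem e _ hze
  · obtain ⟨y, ⟨w, ⟨hwZ, hwV⟩, rfl⟩, hy⟩ := mem_closure_iff.1 (hd (Set.mem_image_of_mem e hx))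
      (e '' (Z ∩ V)) (e.isOpen_image_of_subset_source (hZ.inter hV)
        (Set.inter_subset_right.trans hVe)) (Set.mem_image_of_mem e ⟨hxZ, hx⟩)
    refine ⟨w, hwZ, fun h => hy ?_⟩
    have hw := e.map_source (hVe hwV)
    rw [hg, chartExtend_of_mem e _ (hVe hwV)] at h
    rw [← e.right_inv (hmaps hw), h]

theorem ContainsChartIsotopies.locallyMixing (hG : ContainsChartIsotopies P G)
    (hP : EuclMixing P) : LocallyMixing G M := by
  intro p N hN
  obtain ⟨e, hpe, he⟩ := hG p
  have hT : e.target ∩ e.symm ⁻¹' N ∈ 𝓝 (e p) :=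
    Filter.inter_mem (e.open_target.mem_nhds (e.map_source hpe))
      ((e.continuousAt_symm (e.map_source hpe)).preimage_mem_nhds (by rwa [e.left_inv hpe]))
  obtain ⟨r, hr, hrT⟩ := Metric.nhds_basis_closedBall.mem_iff.1 hT
  obtain ⟨δ, hδ, hmix⟩ := hP (e p) r hr
  refine ⟨e.source ∩ e ⁻¹' Metric.ball (e p) δ, Filter.inter_mem (e.open_source.mem_nhds hpe)
    ((e.continuousAt hpe).preimage_mem_nhds (Metric.ball_mem_nhds _ hδ)), fun x hx y hy => ?_⟩
  obtain ⟨F, hF, hPF, hxy⟩ := hmix (e x) hx.2 (e y) hy.2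
  obtain ⟨g, hg⟩ := he F _ _ hF hPF Metric.ball_subset_closedBall
    (isCompact_closedBall (e p) r) fun z hz => (hrT hz).1
  refine ⟨g, ?_, fun z hz => ?_⟩
  · rw [hg, chartExtend_of_mem e _ hx.1, hxy, e.left_inv hy.1]
  · rw [hg]
    by_cases hze : z ∈ e.source
    · rw [chartExtend_of_mem e _ hze, hF.fixed 1, e.left_inv hze]
      intro h
      have := (hrT (Metric.ball_subset_closedBall h)).2
      rw [Set.mem_preimage, e.left_inv hze] at this
      exact hz this
    · exact chartExtend_of_notMem e _ hze

end Transfer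

/-! ### Pushes: isotopies of `ℝⁿ` in one direction -/

section Push

open Topology

variable {n : ℕ}

/-- The time profile of a push: smooth, bounded by `1`, zero at `0` and one at `1`. -/
noncomputable def timeProfile (t : ℝ) : ℝ := 2 * t / (1 + t ^ 2)

theorem contDiff_timeProfile : ContDiff ℝ ∞ timeProfile :=
  (contDiff_const.mul contDiff_id).div (contDiff_const.add (contDiff_id.pow 2))
    fun t => by positivity

theorem abs_timeProfile_le (t : ℝ) : |timeProfile t| ≤ 1 := by
  have h : 0 < 1 + t ^ 2 := by positivity
  rw [timeProfile, abs_div, abs_of_pos h, div_le_one h, abs_le]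
  constructor <;> nlinarith [sq_nonneg (t + 1), sq_nonneg (t - 1)]

/-- Pushing in the direction `w` with the speed `f` is an isotopy if the derivative of `f • w` is
small: all its maps are small perturbations of the identity. -/
theorem exists_push {f : EuclideanSpace ℝ (Fin n) → ℝ} (hf : ContDiff ℝ ∞ f)
    {w : EuclideanSpace ℝ (Fin n)} {L : ℝ} (hL : ∀ y, ‖fderiv ℝ f y‖ ≤ L) (hLw : L * ‖w‖ ≤ 1 / 2)
    {V : Set (EuclideanSpace ℝ (Fin n))} (hV : ∀ y ∉ V, f y = 0) :
    ∃ F : ℝ → (EuclideanSpace ℝ (Fin n) ≃ₜ EuclideanSpace ℝ (Fin n)),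
      IsEuclIsotopy F V ∧ ∀ y, F 1 y = y + f y • w := by
  have hlip : ∀ x y, |f x - f y| ≤ L * ‖x - y‖ := fun x y =>
    Convex.norm_image_sub_le_of_norm_fderiv_le (fun z _ => hf.differentiable (by simp) z)
      (fun z _ => hL z) convex_univ (Set.mem_univ y) (Set.mem_univ x)
  have happrox : ∀ t, ApproximatesLinearOn
      (fun y => y + (timeProfile t * f y) • w)
      (ContinuousLinearEquiv.refl ℝ (EuclideanSpace ℝ (Fin n)) :
        EuclideanSpace ℝ (Fin n) →L[ℝ] EuclideanSpace ℝ (Fin n)) Set.univ (1 / 2) := by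
    intro t x _ y _
    have e : x + (timeProfile t * f x) • w - (y + (timeProfile t * f y) • w) - (x - y) =
        (timeProfile t * (f x - f y)) • w := by module
    show ‖x + (timeProfile t * f x) • w - (y + (timeProfile t * f y) • w) - (x - y)‖ ≤ _
    rw [e, norm_smul, norm_mul, Real.norm_eq_abs, Real.norm_eq_abs]
    calc |timeProfile t| * |f x - f y| * ‖w‖ ≤ 1 * (L * ‖x - y‖) * ‖w‖ := by
          gcongr
          · exact abs_timeProfile_le t
          · exact hlip x y
      _ = L * ‖w‖ * ‖x - y‖ := by ring
      _ ≤ 1 / 2 * ‖x - y‖ := by gcongr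
      _ = _ := by norm_num
  have hc : Subsingleton (EuclideanSpace ℝ (Fin n)) ∨ (1 / 2 : NNReal) <
      ‖((ContinuousLinearEquiv.refl ℝ (EuclideanSpace ℝ (Fin n))).symm :
        EuclideanSpace ℝ (Fin n) →L[ℝ] EuclideanSpace ℝ (Fin n))‖₊⁻¹ := by
    rcases subsingleton_or_nontrivial (EuclideanSpace ℝ (Fin n)) with h | h
    · exact Or.inl h
    · refine Or.inr ?_
      have : ‖((ContinuousLinearEquiv.refl ℝ (EuclideanSpace ℝ (Fin n))).symm :
        EuclideanSpace ℝ (Fin n) →L[ℝ] EuclideanSpace ℝ (Fin n))‖₊ = 1 :=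
        NNReal.eq ContinuousLinearMap.norm_id
      rw [this, inv_one]
      exact NNReal.half_lt_self one_ne_zero
  let F : ℝ → (EuclideanSpace ℝ (Fin n) ≃ₜ EuclideanSpace ℝ (Fin n)) := fun t =>
    (happrox t).toHomeomorph _ hc
  have hF : ∀ t y, F t y = y + (timeProfile t * f y) • w := fun t y => rfl
  have hsmooth : ContDiff ℝ ∞ fun p : ℝ × EuclideanSpace ℝ (Fin n) => F p.1 p.2 := by
    simp only [hF]
    exact contDiff_snd.add (((contDiff_timeProfile.comp contDiff_fst).mul
      (hf.comp contDiff_snd)).smul contDiff_const)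
  refine ⟨F, ⟨?_, hsmooth, fun t => ?_, fun t y hy => by rw [hF, hV y hy]; simp⟩,
    fun y => by rw [hF]; norm_num [timeProfile]⟩
  · ext1 y
    rw [hF]
    simp [timeProfile]
  · have hnorm : ∀ y, ‖-((timeProfile t • fderiv ℝ f y).smulRight w)‖ < 1 := by
      intro y
      rw [norm_neg, ContinuousLinearMap.norm_smulRight_apply, norm_smul, Real.norm_eq_abs]
      calc |timeProfile t| * ‖fderiv ℝ f y‖ * ‖w‖ ≤ 1 * L * ‖w‖ := by
            gcongr
            · exact abs_timeProfile_le t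
            · exact hL y
        _ < 1 := by linarith
    have hFt : ContDiff ℝ ∞ (F t) :=
      contDiff_id.add ((contDiff_const.mul hf).smul contDiff_const)
    refine (F t).contDiff_symm
      (f₀' := fun y => ContinuousLinearEquiv.unitsEquiv ℝ _ (Units.oneSub _ (hnorm y)))
      (fun y => ?_) hFt
    have h1 : HasFDerivAt f (fderiv ℝ f y) y := (hf.differentiable (by simp) y).hasFDerivAt
    have h2 : HasFDerivAt (fun z => z + (timeProfile t * f z) • w)
        (ContinuousLinearMap.id ℝ _ + (timeProfile t • fderiv ℝ f y).smulRight w) y :=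
      (hasFDerivAt_id y).add ((h1.const_mul (timeProfile t)).smul_const w)
    have h3 : ((ContinuousLinearEquiv.unitsEquiv ℝ _ (Units.oneSub _ (hnorm y)) :
        EuclideanSpace ℝ (Fin n) ≃L[ℝ] EuclideanSpace ℝ (Fin n)) :
          EuclideanSpace ℝ (Fin n) →L[ℝ] EuclideanSpace ℝ (Fin n)) =
        ContinuousLinearMap.id ℝ _ + (timeProfile t • fderiv ℝ f y).smulRight w := by
      show (Units.oneSub _ (hnorm y)).val = _
      rw [Units.val_oneSub, sub_neg_eq_add]
      rfl
    rw [h3]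
    exact h2

/-- A push whose speed is nonzero exactly on `V`. -/
theorem euclDense_true (hn : 0 < n) :
    EuclDense fun _ : EuclideanSpace ℝ (Fin n) ≃ₜ EuclideanSpace ℝ (Fin n) => True := by
  intro V hV hVb
  obtain ⟨f, hfV, hf, -⟩ := hV.exists_contDiff_support_eq (n := ⊤)
  have hfc : HasCompactSupport f := by
    rw [HasCompactSupport, tsupport, hfV]
    exact hVb.isCompact_closure
  obtain ⟨C, hC⟩ := (hf.continuous_fderiv (by simp)).bounded_above_of_compact_support
    (hfc.fderiv ℝ)
  have hC0 : 0 ≤ C := (norm_nonneg _).trans (hC 0)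
  let u : EuclideanSpace ℝ (Fin n) := EuclideanSpace.single ⟨0, hn⟩ 1
  have hu : ‖u‖ = 1 := by simp [u]
  obtain ⟨F, hF, hF1⟩ := exists_push hf (w := (2 * (C + 1))⁻¹ • u) hC (V := V) (by
      rw [norm_smul, hu, Real.norm_eq_abs, abs_of_pos (by positivity), mul_one,
        ← div_eq_mul_inv, div_le_iff₀ (by positivity)]
      linarith)
    fun y hy => by rwa [← hfV, Function.notMem_support] at hy
  refine ⟨F, hF, fun _ => trivial, fun y hy => subset_closure ?_⟩
  rw [← hfV, Function.mem_support] at hy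
  have hu0 : u ≠ 0 := norm_ne_zero_iff.1 (by rw [hu]; exact one_ne_zero)
  have hC1 : (2 * (C + 1))⁻¹ ≠ 0 := by positivity
  show F 1 y ≠ y
  rw [hF1]
  simpa using ⟨hy, by simpa using hC1, hu0⟩

/-- A push from `x` in the direction `y - x`, cut off by a fixed bump function: the derivative of
the latter bounds the distance that is admissible for `exists_push`. -/
theorem euclMixing_true :
    EuclMixing fun _ : EuclideanSpace ℝ (Fin n) ≃ₜ EuclideanSpace ℝ (Fin n) => True := by
  intro c r hr
  let f : ContDiffBump c := ⟨r / 4, r / 2, by positivity, by linarith⟩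
  have hf : ContDiff ℝ ∞ f := f.contDiff
  obtain ⟨C, hC⟩ := (hf.continuous_fderiv (by simp)).bounded_above_of_compact_support
    (f.hasCompactSupport.fderiv ℝ)
  have hC0 : 0 ≤ C := (norm_nonneg _).trans (hC 0)
  refine ⟨min (r / 4) (4 * (C + 1))⁻¹, by positivity, fun x hx y hy => ?_⟩
  have hxy : ‖y - x‖ ≤ 2 * (4 * (C + 1))⁻¹ := by
    rw [← dist_eq_norm]
    have h1 := (Metric.mem_ball.1 hx).le.trans (min_le_right _ _)
    have h2 := (Metric.mem_ball.1 hy).le.trans (min_le_right _ _)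
    linarith [dist_triangle_right y x c]
  obtain ⟨F, hF, hF1⟩ := exists_push hf (w := y - x) hC (V := Metric.ball c r) (by
      calc C * ‖y - x‖ ≤ C * (2 * (4 * (C + 1))⁻¹) := by gcongr
        _ = C / (2 * (C + 1)) := by field_simp; ring
        _ ≤ 1 / 2 := by
          rw [div_le_iff₀ (by positivity)]
          linarith)
    fun z hz => f.zero_of_le_dist (by
      rw [Metric.mem_ball, not_lt] at hz
      show r / 2 ≤ dist z c
      linarith)
  refine ⟨F, hF, fun _ => trivial, ?_⟩
  have hfx : f x = 1 := f.one_of_mem_closedBall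
    (Metric.ball_subset_closedBall (Metric.ball_subset_ball (min_le_left _ _) hx))
  rw [hF1, hfx]
  simp

end Push

/-! ### Rotations in a plane -/

theorem det_id_add_smulRight {E : Type*} [NormedAddCommGroup E] [NormedSpace ℝ E]
    [FiniteDimensional ℝ E] (f : E →L[ℝ] ℝ) (v : E) :
    (ContinuousLinearMap.id ℝ E + f.smulRight v).det = 1 + f v :=
  LinearMap.transvection.det (f : E →ₗ[ℝ] ℝ) v

section Rotation

open scoped RealInnerProductSpace

variable {E : Type*} [NormedAddCommGroup E] [InnerProductSpace ℝ E]

/-- `J` is the quarter turn of a plane, extended by zero on the orthogonal complement. -/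
structure IsQuarterTurn (J : E →L[ℝ] E) : Prop where
  skew : ∀ x y, ⟪J x, y⟫ = -⟪x, J y⟫
  cube : ∀ x, J (J (J x)) = -J x

/-- The rotation by the angle `2 arctan s` in the plane of `J`, in its rational parametrization. -/
noncomputable def planeRotation (J : E →L[ℝ] E) (s : ℝ) : E →L[ℝ] E :=
  ContinuousLinearMap.id ℝ E + (2 * s / (1 + s ^ 2)) • J + (2 * s ^ 2 / (1 + s ^ 2)) • J.comp J

theorem planeRotation_apply (J : E →L[ℝ] E) (s : ℝ) (x : E) :
    planeRotation J s x = x + (2 * s / (1 + s ^ 2)) • J x + (2 * s ^ 2 / (1 + s ^ 2)) • J (J x) :=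
  rfl

variable {J : E →L[ℝ] E} (hJ : IsQuarterTurn J)

include hJ

theorem IsQuarterTurn.inner_self (x : E) : ⟪x, J x⟫ = 0 := by
  have := hJ.skew x x
  rw [real_inner_comm] at this
  linarith

theorem planeRotation_neg_apply (s : ℝ) (x : E) :
    planeRotation J (-s) (planeRotation J s x) = x := by
  have hs : (1 + s ^ 2 : ℝ) ≠ 0 := by positivity
  simp only [planeRotation_apply, map_add, map_smul, hJ.cube, smul_add, smul_smul, smul_neg,
    map_neg]
  match_scalars
  · rfl
  · field_simp
    ring
  · field_simp
    ring

theorem norm_planeRotation (s : ℝ) (x : E) : ‖planeRotation J s x‖ = ‖x‖ := by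
  have hs : (1 + s ^ 2 : ℝ) ≠ 0 := by positivity
  have h1 := hJ.inner_self x
  have h2 := hJ.inner_self (J x)
  have h3 : ⟪x, J (J x)⟫ = -‖J x‖ ^ 2 := by
    have := hJ.skew x (J x)
    rw [real_inner_self_eq_norm_sq] at this
    linarith
  have h4 : ‖J (J x)‖ ^ 2 = ‖J x‖ ^ 2 := by
    have := hJ.skew (J x) (J (J x))
    rw [hJ.cube, inner_neg_right, neg_neg, real_inner_self_eq_norm_sq,
      real_inner_self_eq_norm_sq] at this
    exact this
  rw [← sq_eq_sq₀ (norm_nonneg _) (norm_nonneg _), planeRotation_apply, norm_add_sq_real,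
    norm_add_sq_real, inner_add_left]
  simp only [inner_smul_left, inner_smul_right, norm_smul, mul_pow, Real.norm_eq_abs, sq_abs, h1,
    h2, h3, h4, RCLike.conj_to_real]
  field_simp
  ring

theorem abs_det_planeRotation [FiniteDimensional ℝ E] (s : ℝ) :
    |(planeRotation J s).det| = 1 := by
  let R : E →ₗᵢ[ℝ] E := ⟨(planeRotation J s : E →ₗ[ℝ] E), norm_planeRotation hJ s⟩
  have h := R.toLinearMap.normDet_eq_norm_det
  rw [R.normDet_eq_one, Real.norm_eq_abs] at h
  exact h.symm

theorem apply_eq_zero_of_planeRotation_eq {s : ℝ} (hs : s ≠ 0) {x : E}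
    (h : planeRotation J s x = x) : J x = 0 := by
  have hs' : (0 : ℝ) < 1 + s ^ 2 := by positivity
  rw [planeRotation_apply, add_assoc, add_eq_left] at h
  have h2 := congrArg (fun z => ⟪J x, z⟫) h
  simp only [inner_add_right, inner_smul_right, hJ.inner_self, inner_zero_right, mul_zero,
    add_zero, real_inner_self_eq_norm_sq] at h2
  rcases mul_eq_zero.1 h2 with h3 | h3
  · rcases div_eq_zero_iff.1 h3 with h4 | h4
    · exact absurd (by linarith) hs
    · exact absurd h4 hs'.ne'
  · exact norm_eq_zero.1 (pow_eq_zero_iff two_ne_zero |>.1 h3)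

end Rotation

/-! ### Swirls -/

section Swirl

open scoped RealInnerProductSpace
open Topology

variable {n : ℕ}

/-- Swirl data: `θ` gives the speed of rotation of the points of `ℝⁿ`; around each point at which it
does not vanish there is a ball on which it is a function of the distance to the centre `c`, and on
which `ξ` is the vector from the centre multiplied by `θ`. -/
structure IsSwirlData (θ : EuclideanSpace ℝ (Fin n) → ℝ)
    (ξ : EuclideanSpace ℝ (Fin n) → EuclideanSpace ℝ (Fin n)) : Prop where
  contDiff_speed : ContDiff ℝ ∞ θ
  contDiff_arm : ContDiff ℝ ∞ ξ
  arm_eq_zero : ∀ x, θ x = 0 → ξ x = 0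
  radial : ∀ x, θ x ≠ 0 → ∃ c r, x ∈ Metric.ball c r ∧ ∃ η : ℝ → ℝ, Differentiable ℝ η ∧
    ∀ y ∈ Metric.ball c r, θ y = η (‖y - c‖ ^ 2) ∧ ξ y = θ y • (y - c)

/-- The swirl at the time `t`. By `swirl_eq` it rotates each of the balls of the swirl
data around its centre; the formula shows that it is smooth everywhere. -/
noncomputable def swirl (J : EuclideanSpace ℝ (Fin n) →L[ℝ] EuclideanSpace ℝ (Fin n))
    (θ : EuclideanSpace ℝ (Fin n) → ℝ) (ξ : EuclideanSpace ℝ (Fin n) → EuclideanSpace ℝ (Fin n))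
    (t : ℝ) (x : EuclideanSpace ℝ (Fin n)) : EuclideanSpace ℝ (Fin n) :=
  x + (2 * t / (1 + (t * θ x) ^ 2)) • J (ξ x) +
    (2 * t ^ 2 * θ x / (1 + (t * θ x) ^ 2)) • J (J (ξ x))

variable {J : EuclideanSpace ℝ (Fin n) →L[ℝ] EuclideanSpace ℝ (Fin n)}
  {θ : EuclideanSpace ℝ (Fin n) → ℝ} {ξ : EuclideanSpace ℝ (Fin n) → EuclideanSpace ℝ (Fin n)}

theorem swirl_eq {t : ℝ} {x c : EuclideanSpace ℝ (Fin n)} (h : ξ x = θ x • (x - c)) :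
    swirl J θ ξ t x = c + planeRotation J (t * θ x) (x - c) := by
  have hs : (1 + (t * θ x) ^ 2 : ℝ) ≠ 0 := by positivity
  rw [swirl, h, planeRotation_apply]
  simp only [map_smul, smul_smul]
  match_scalars
  · norm_num
  · field_simp
  · field_simp
  · norm_num

theorem swirl_eq_self (h : IsSwirlData θ ξ) {t : ℝ} {x : EuclideanSpace ℝ (Fin n)}
    (hx : θ x = 0) : swirl J θ ξ t x = x := by
  simp [swirl, h.arm_eq_zero x hx]

theorem contDiff_swirl (h : IsSwirlData θ ξ) :
    ContDiff ℝ ∞ fun p : ℝ × EuclideanSpace ℝ (Fin n) => swirl J θ ξ p.1 p.2 := by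
  have hθ : ContDiff ℝ ∞ fun p : ℝ × EuclideanSpace ℝ (Fin n) => θ p.2 :=
    h.contDiff_speed.comp contDiff_snd
  have hξ : ContDiff ℝ ∞ fun p : ℝ × EuclideanSpace ℝ (Fin n) => ξ p.2 :=
    h.contDiff_arm.comp contDiff_snd
  have hden : ContDiff ℝ ∞ fun p : ℝ × EuclideanSpace ℝ (Fin n) => 1 + (p.1 * θ p.2) ^ 2 :=
    contDiff_const.add ((contDiff_fst.mul hθ).pow 2)
  have hne : ∀ p : ℝ × EuclideanSpace ℝ (Fin n), 1 + (p.1 * θ p.2) ^ 2 ≠ 0 := fun p => by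
    positivity
  have hJξ : ContDiff ℝ ∞ fun p : ℝ × EuclideanSpace ℝ (Fin n) => J (ξ p.2) :=
    J.contDiff.comp hξ
  exact (contDiff_snd.add (((contDiff_const.mul contDiff_fst).div hden hne).smul hJξ)).add
    ((((contDiff_const.mul (contDiff_fst.pow 2)).mul hθ).div hden hne).smul (J.contDiff.comp hJξ))

variable (hJ : IsQuarterTurn J)

include hJ

/-- A swirl preserves the speed, hence it is inverted by the swirl at the time `-t`. -/
theorem swirl_invariant (h : IsSwirlData θ ξ) (t : ℝ) (x : EuclideanSpace ℝ (Fin n)) :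
    θ (swirl J θ ξ t x) = θ x ∧ swirl J θ ξ (-t) (swirl J θ ξ t x) = x := by
  by_cases hx : θ x = 0
  · rw [swirl_eq_self h hx, swirl_eq_self h hx]
    exact ⟨rfl, rfl⟩
  · obtain ⟨c, r, hxc, η, -, hη⟩ := h.radial x hx
    have h1 := swirl_eq (J := J) (t := t) (hη x hxc).2
    have h2 : swirl J θ ξ t x - c = planeRotation J (t * θ x) (x - c) := by
      rw [h1, add_sub_cancel_left]
    have h3 : ‖swirl J θ ξ t x - c‖ = ‖x - c‖ := by rw [h2, norm_planeRotation hJ]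
    have hmem : swirl J θ ξ t x ∈ Metric.ball c r := by
      rw [Metric.mem_ball, dist_eq_norm, h3, ← dist_eq_norm]
      exact hxc
    have h4 : θ (swirl J θ ξ t x) = θ x := by rw [(hη _ hmem).1, h3, (hη x hxc).1]
    refine ⟨h4, ?_⟩
    rw [swirl_eq (hη _ hmem).2, h4, h2, neg_mul, planeRotation_neg_apply hJ, add_sub_cancel]

/-- The swirl as a homeomorphism. -/
noncomputable def swirlHomeomorph (h : IsSwirlData θ ξ) (t : ℝ) :
    EuclideanSpace ℝ (Fin n) ≃ₜ EuclideanSpace ℝ (Fin n) where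
  toFun := swirl J θ ξ t
  invFun := swirl J θ ξ (-t)
  left_inv x := (swirl_invariant hJ h t x).2
  right_inv x := by simpa using (swirl_invariant hJ h (-t) x).2
  continuous_toFun := ((contDiff_swirl h).comp
    (contDiff_const.prodMk contDiff_id : ContDiff ℝ ∞ fun y => (t, y))).continuous
  continuous_invFun := ((contDiff_swirl h).comp
    (contDiff_const.prodMk contDiff_id : ContDiff ℝ ∞ fun y => (-t, y))).continuous

theorem isEuclIsotopy_swirl (h : IsSwirlData θ ξ) {V : Set (EuclideanSpace ℝ (Fin n))}
    (hV : ∀ y ∉ V, θ y = 0) : IsEuclIsotopy (swirlHomeomorph hJ h) V where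
  zero := by
    ext1 y
    show swirl J θ ξ 0 y = y
    simp [swirl]
  contDiff := contDiff_swirl h
  contDiff_symm t := (contDiff_swirl h).comp
    (contDiff_const.prodMk contDiff_id : ContDiff ℝ ∞ fun y => (-t, y))
  fixed _ y hy := swirl_eq_self h (hV y hy)

/-- The derivative of a swirl is the composition of a rotation with a transvection along the
direction of rotation, in which the speed is constant. -/
theorem abs_det_fderiv_swirl (h : IsSwirlData θ ξ) (t : ℝ) {x : EuclideanSpace ℝ (Fin n)}
    (hx : θ x ≠ 0) :
    DifferentiableAt ℝ (swirl J θ ξ t) x ∧ |(fderiv ℝ (swirl J θ ξ t) x).det| = 1 := by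
  obtain ⟨c, r, hxc, η, hη, hθ⟩ := h.radial x hx
  have hθ' : HasFDerivAt θ (fderiv ℝ θ x) x :=
    (h.contDiff_speed.differentiable (by simp) x).hasFDerivAt
  have hrad : fderiv ℝ θ x (J (x - c)) = 0 := by
    have h1 : HasFDerivAt (fun y => ‖y - c‖ ^ 2)
        (2 • (innerSL ℝ (x - c)).comp
        (ContinuousLinearMap.id ℝ (EuclideanSpace ℝ (Fin n)))) x :=
      ((hasFDerivAt_id (𝕜 := ℝ) x).sub_const c).norm_sq
    have h2 := (hη (‖x - c‖ ^ 2)).hasDerivAt.comp_hasFDerivAt x h1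
    have h3 : θ =ᶠ[𝓝 x] η ∘ fun y => ‖y - c‖ ^ 2 :=
      Filter.eventually_of_mem (Metric.isOpen_ball.mem_nhds hxc) fun y hy => (hθ y hy).1
    rw [hθ'.unique (h2.congr_of_eventuallyEq h3)]
    simp only [ContinuousLinearMap.comp_id, smul_apply, innerSL_apply_apply,
      hJ.inner_self, smul_zero]
  let s : ℝ := t * θ x
  have hs : (1 + s ^ 2 : ℝ) ≠ 0 := by positivity
  have hcos : HasFDerivAt (fun y => 2 * (t * θ y) / (1 + (t * θ y) ^ 2))
      ((2 * (1 - s ^ 2) / (1 + s ^ 2) ^ 2) • t • fderiv ℝ θ x) x := by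
    have h1 : HasDerivAt (fun u : ℝ => 2 * u / (1 + u ^ 2))
        (2 * (1 - s ^ 2) / (1 + s ^ 2) ^ 2) s := by
      refine (((hasDerivAt_id s).const_mul 2).div (((hasDerivAt_id s).pow 2).const_add 1)
        hs).congr_deriv ?_
      simp
      ring
    exact h1.comp_hasFDerivAt x (hθ'.const_mul t)
  have hsin : HasFDerivAt (fun y => 2 * (t * θ y) ^ 2 / (1 + (t * θ y) ^ 2))
      ((4 * s / (1 + s ^ 2) ^ 2) • t • fderiv ℝ θ x) x := by
    have h1 : HasDerivAt (fun u : ℝ => 2 * u ^ 2 / (1 + u ^ 2)) (4 * s / (1 + s ^ 2) ^ 2) s := by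
      refine ((((hasDerivAt_id s).pow 2).const_mul 2).div (((hasDerivAt_id s).pow 2).const_add 1)
        hs).congr_deriv ?_
      simp
      ring
    exact h1.comp_hasFDerivAt x (hθ'.const_mul t)
  have hsub : HasFDerivAt (fun y => y - c) (ContinuousLinearMap.id ℝ _) x :=
    (hasFDerivAt_id x).sub_const c
  have hJ1 : HasFDerivAt (fun y => J (y - c)) J x := J.hasFDerivAt.comp x hsub
  have hJ2 : HasFDerivAt (fun y => J (J (y - c))) (J.comp J) x := J.hasFDerivAt.comp x hJ1
  have hrot : HasFDerivAt (fun y => c + planeRotation J (t * θ y) (y - c))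
      ((planeRotation J s).comp (ContinuousLinearMap.id ℝ _ +
        ((fderiv ℝ θ x).smulRight ((2 * t / (1 + s ^ 2)) • J (x - c))))) x := by
    have := ((hsub.add (hcos.smul hJ1)).add (hsin.smul hJ2)).const_add c
    refine this.congr_fderiv ?_
    ext1 z
    generalize x - c = v
    simp only [add_apply, smul_apply,
      ContinuousLinearMap.comp_apply, ContinuousLinearMap.smulRight_apply,
      ContinuousLinearMap.id_apply, planeRotation_apply, map_add, map_smul, hJ.cube, smul_add,
      smul_smul, smul_neg, smul_eq_mul]
    match_scalars
    · rfl
    all_goals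
      field_simp
      ring
  have hmain : HasFDerivAt (swirl J θ ξ t) _ x := hrot.congr_of_eventuallyEq
    (Filter.eventually_of_mem (Metric.isOpen_ball.mem_nhds hxc) fun y hy => swirl_eq (hθ y hy).2)
  refine ⟨hmain.differentiableAt, ?_⟩
  rw [hmain.fderiv]
  have hdet : (ContinuousLinearMap.id ℝ (EuclideanSpace ℝ (Fin n)) +
      ((fderiv ℝ θ x).smulRight ((2 * t / (1 + s ^ 2)) • J (x - c)))).det = 1 := by
    rw [det_id_add_smulRight, map_smul, hrad, smul_zero, add_zero]
  have hmul : ∀ A B : EuclideanSpace ℝ (Fin n) →L[ℝ] EuclideanSpace ℝ (Fin n),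
      (A.comp B).det = A.det * B.det := fun A B => LinearMap.det_comp _ _
  rw [hmul, abs_mul, abs_det_planeRotation hJ, hdet, abs_one, one_mul]

theorem measurePreserving_swirl (h : IsSwirlData θ ξ) (t : ℝ) :
    MeasurePreserving (swirlHomeomorph hJ h t) volume volume := by
  let g := swirlHomeomorph hJ h t
  have hO : MeasurableSet {x | θ x ≠ 0} :=
    (isOpen_ne_fun h.contDiff_speed.continuous continuous_const).measurableSet
  refine ⟨g.continuous.measurable, Measure.ext fun A hA => ?_⟩
  rw [Measure.map_apply g.continuous.measurable hA, ← measure_inter_add_sdiff _ hO,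
    ← measure_inter_add_sdiff A hO]
  congr 1
  · have hD := fun x (hx : x ∈ {x | θ x ≠ 0}) => abs_det_fderiv_swirl hJ h t hx
    have himage : g '' (g ⁻¹' A ∩ {x | θ x ≠ 0}) = A ∩ {x | θ x ≠ 0} := by
      have : {x | θ x ≠ 0} = g ⁻¹' {x | θ x ≠ 0} := by
        ext x
        show θ x ≠ 0 ↔ θ (swirl J θ ξ t x) ≠ 0
        rw [(swirl_invariant hJ h t x).1]
      conv_lhs => rw [this]
      rw [← Set.preimage_inter, Set.image_preimage_eq _ g.surjective]
    have hB : MeasurableSet (g ⁻¹' A ∩ {x | θ x ≠ 0}) := (g.continuous.measurable hA).inter hO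
    have hvol := lintegral_abs_det_fderiv_eq_addHaar_image volume hB
      (fun x hx => (hD x hx.2).1.hasFDerivAt.hasFDerivWithinAt) g.injective.injOn
    rw [setLIntegral_congr_fun hB (g := fun _ => 1) fun x hx => by simp [(hD x hx.2).2],
      setLIntegral_one] at hvol
    rw [← himage]
    exact hvol
  · congr 1
    ext x
    refine and_congr_left fun hx => ?_
    have : g x = x := swirl_eq_self h (not_not.1 hx)
    rw [Set.mem_preimage, this]

end Swirl

/-! ### Existence of swirls -/

section SwirlExistence

open scoped RealInnerProductSpace
open Topology

section PlaneTurn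

variable {E : Type*} [NormedAddCommGroup E] [InnerProductSpace ℝ E]

/-- The quarter turn from `u` to `v`. -/
noncomputable def planeTurn (u v : E) : E →L[ℝ] E :=
  (innerSL ℝ u).smulRight v - (innerSL ℝ v).smulRight u

theorem planeTurn_apply (u v x : E) : planeTurn u v x = ⟪u, x⟫ • v - ⟪v, x⟫ • u := rfl

theorem isQuarterTurn_planeTurn {u v : E} (hu : ‖u‖ = 1) (hv : ‖v‖ = 1) (huv : ⟪u, v⟫ = 0) :
    IsQuarterTurn (planeTurn u v) where
  skew x y := by
    simp only [planeTurn_apply, inner_sub_left, inner_sub_right, real_inner_smul_left,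
      real_inner_smul_right, real_inner_comm u x, real_inner_comm v x]
    ring
  cube x := by
    have hu' : ⟪u, u⟫ = 1 := by rw [real_inner_self_eq_norm_sq, hu, one_pow]
    have hv' : ⟪v, v⟫ = 1 := by rw [real_inner_self_eq_norm_sq, hv, one_pow]
    have hvu : ⟪v, u⟫ = 0 := by rw [real_inner_comm, huv]
    simp only [planeTurn_apply, inner_sub_right, real_inner_smul_right, hu', hv', huv, hvu]
    module

theorem exists_unit_orthogonal [FiniteDimensional ℝ E] (h2 : 2 ≤ Module.finrank ℝ E) (u : E) :
    ∃ v : E, ‖v‖ = 1 ∧ ⟪u, v⟫ = 0 := by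
  have h1 : Module.finrank ℝ (Submodule.span ℝ {u}) ≤ 1 :=
    (finrank_span_le_card _).trans (by simp)
  have h3 := (Submodule.span ℝ {u}).finrank_add_finrank_orthogonal
  have : Nontrivial (Submodule.span ℝ {u})ᗮ := Module.nontrivial_of_finrank_pos (R := ℝ) (by omega)
  obtain ⟨w, hw⟩ := exists_ne (0 : (Submodule.span ℝ {u})ᗮ)
  have hw' : (w : E) ≠ 0 := fun h => hw (Subtype.ext h)
  refine ⟨‖(w : E)‖⁻¹ • (w : E), by
    rw [norm_smul, norm_inv, norm_norm, inv_mul_cancel₀ (norm_ne_zero_iff.2 hw')], ?_⟩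
  rw [real_inner_smul_right, Submodule.mem_orthogonal_singleton_iff_inner_right.1 w.2, mul_zero]

end PlaneTurn

/-- For countably many smooth functions with compact support there are positive weights for which
the weighted sum is smooth. -/
theorem exists_weights_contDiff_tsum {ι E F : Type*} [Countable ι] [NormedAddCommGroup E]
    [NormedSpace ℝ E] [NormedAddCommGroup F] [NormedSpace ℝ F] [CompleteSpace F]
    (f : ι → E → F) (hf : ∀ i, ContDiff ℝ ∞ (f i)) (hc : ∀ i, HasCompactSupport (f i)) :
    ∃ ε : ι → ℝ, (∀ i, 0 < ε i) ∧ ContDiff ℝ ∞ fun x => ∑' i, ε i • f i x := by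
  obtain ⟨idx, hidx⟩ := exists_injective_nat ι
  have hbound : ∀ (i : ι) (k : ℕ), ∃ C, ∀ x, ‖iteratedFDeriv ℝ k (f i) x‖ ≤ C := fun i k =>
    ((hf i).continuous_iteratedFDeriv (by exact_mod_cast le_top)).bounded_above_of_compact_support
      ((hc i).iteratedFDeriv k)
  choose C hC using hbound
  have hC0 : ∀ i k, 0 ≤ C i k := fun i k => (norm_nonneg _).trans (hC i k 0)
  let D : ι → ℝ := fun i => 1 + ∑ k ∈ Finset.range (idx i + 1), C i k
  have hD : ∀ i, 0 < D i := fun i => by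
    have := Finset.sum_nonneg fun k (_ : k ∈ Finset.range (idx i + 1)) => hC0 i k
    positivity
  refine ⟨fun i => (1 / 2) ^ idx i / D i, fun i => div_pos (by positivity) (hD i), ?_⟩
  refine contDiff_tsum_of_eventually (N := ⊤) (v := fun _ i => (1 / 2 : ℝ) ^ idx i)
    (fun i => contDiff_const.smul (hf i))
    (fun _ _ => (summable_geometric_of_lt_one (by norm_num) (by norm_num)).comp_injective hidx)
    fun k _ => ?_
  have hfin : {i | idx i < k}.Finite := (Set.finite_lt_nat k).preimage hidx.injOn
  filter_upwards [hfin.compl_mem_cofinite] with i hi x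
  have hki : k ≤ idx i := not_lt.1 hi
  have hle : C i k ≤ D i := by
    have := Finset.single_le_sum (f := C i) (fun j _ => hC0 i j)
      (Finset.mem_range.2 (by omega : k < idx i + 1))
    simp only [D]
    linarith
  have h1 : iteratedFDeriv ℝ k (fun x => ((1 / 2 : ℝ) ^ idx i / D i) • f i x) x =
      ((1 / 2 : ℝ) ^ idx i / D i) • iteratedFDeriv ℝ k (f i) x :=
    iteratedFDeriv_const_smul_apply' ((hf i).contDiffAt.of_le (by exact_mod_cast le_top))
  rw [h1, norm_smul, Real.norm_eq_abs, abs_of_pos (div_pos (by positivity) (hD i)),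
    div_mul_eq_mul_div, div_le_iff₀ (hD i)]
  gcongr
  exact (hC i k x).trans hle

variable {n : ℕ}

/-- A smooth radial bump that is positive exactly in the ball. -/
noncomputable def radialBump (c : EuclideanSpace ℝ (Fin n)) (r : ℝ)
    (y : EuclideanSpace ℝ (Fin n)) : ℝ :=
  expNegInvGlue (r ^ 2 - ‖y - c‖ ^ 2)

theorem contDiff_radialBump (c : EuclideanSpace ℝ (Fin n)) (r : ℝ) :
    ContDiff ℝ ∞ (radialBump c r) :=
  expNegInvGlue.contDiff.comp (contDiff_const.sub ((contDiff_id.sub contDiff_const).norm_sq ℝ))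

theorem radialBump_pos {c : EuclideanSpace ℝ (Fin n)} {r : ℝ} {y : EuclideanSpace ℝ (Fin n)}
    (hy : y ∈ Metric.ball c r) : 0 < radialBump c r y := by
  rw [Metric.mem_ball, dist_eq_norm] at hy
  exact expNegInvGlue.pos_of_pos (sub_pos.2 (pow_lt_pow_left₀ hy (norm_nonneg _) two_ne_zero))

theorem radialBump_eq_zero {c : EuclideanSpace ℝ (Fin n)} {r : ℝ} (hr : 0 < r)
    {y : EuclideanSpace ℝ (Fin n)} (hy : y ∉ Metric.ball c r) : radialBump c r y = 0 := by
  rw [Metric.mem_ball, dist_eq_norm, not_lt] at hy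
  exact expNegInvGlue.zero_of_nonpos (sub_nonpos.2 (pow_le_pow_left₀ hr.le hy 2))

/-- Swirl data from a family of balls with a radial bump in each of them. -/
theorem isSwirlData_of_balls {ι : Type*} {c : ι → EuclideanSpace ℝ (Fin n)} {r ε : ι → ℝ}
    {θ : EuclideanSpace ℝ (Fin n) → ℝ} {ξ : EuclideanSpace ℝ (Fin n) → EuclideanSpace ℝ (Fin n)}
    (hθ : ContDiff ℝ ∞ θ) (hξ : ContDiff ℝ ∞ ξ)
    (hin : ∀ i, ∀ y ∈ Metric.ball (c i) (r i),
      θ y = ε i * radialBump (c i) (r i) y ∧ ξ y = θ y • (y - c i))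
    (hout : ∀ y, (∀ i, y ∉ Metric.ball (c i) (r i)) → θ y = 0 ∧ ξ y = 0) : IsSwirlData θ ξ where
  contDiff_speed := hθ
  contDiff_arm := hξ
  arm_eq_zero x hx := by
    by_cases h : ∃ i, x ∈ Metric.ball (c i) (r i)
    · obtain ⟨i, hi⟩ := h
      rw [(hin i x hi).2, hx, zero_smul]
    · exact (hout x (not_exists.1 h)).2
  radial x hx := by
    obtain ⟨i, hi⟩ : ∃ i, x ∈ Metric.ball (c i) (r i) := by
      by_contra! h
      exact hx (hout x h).1
    refine ⟨c i, r i, hi, fun q => ε i * expNegInvGlue (r i ^ 2 - q), ?_, hin i⟩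
    have h1 : ContDiff ℝ 1 fun q => expNegInvGlue (r i ^ 2 - q) :=
      (expNegInvGlue.contDiff (n := 1)).comp (contDiff_const.sub contDiff_id)
    exact (h1.differentiable one_ne_zero).const_mul _

/-- A swirl in one ball, centred on the perpendicular bisector, makes a quarter turn from `x`
to `y`. -/
theorem euclMixing_measurePreserving (hn : 2 ≤ n) :
    EuclMixing fun f : EuclideanSpace ℝ (Fin n) ≃ₜ EuclideanSpace ℝ (Fin n) =>
      MeasurePreserving f volume volume := by
  intro p ρ hρ
  refine ⟨ρ / 4, by positivity, fun x hx y hy => ?_⟩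
  by_cases hxy : x = y
  · exact ⟨fun _ => 1, ⟨rfl, contDiff_snd, fun _ => contDiff_id, fun _ _ _ => rfl⟩,
      fun _ => MeasurePreserving.id _, hxy⟩
  obtain ⟨d, hd⟩ : ∃ d, d = (1 / 2 : ℝ) • (y - x) := ⟨_, rfl⟩
  have hd0 : d ≠ 0 := by
    rw [hd]
    exact smul_ne_zero (by norm_num) (sub_ne_zero.2 (Ne.symm hxy))
  have hdpos : 0 < ‖d‖ := norm_pos_iff.2 hd0
  obtain ⟨u, hud⟩ : ∃ u, u = ‖d‖⁻¹ • d := ⟨_, rfl⟩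
  have hu : ‖u‖ = 1 := by
    rw [hud, norm_smul, norm_inv, norm_norm, inv_mul_cancel₀ hdpos.ne']
  have hdu : d = ‖d‖ • u := by rw [hud, smul_inv_smul₀ hdpos.ne']
  obtain ⟨v, hv, huv⟩ := exists_unit_orthogonal (by simpa using hn) u
  have hJ := isQuarterTurn_planeTurn hu hv huv
  have hu' : ⟪u, u⟫ = 1 := by rw [real_inner_self_eq_norm_sq, hu, one_pow]
  have hv' : ⟪v, v⟫ = 1 := by rw [real_inner_self_eq_norm_sq, hv, one_pow]
  have hvu : ⟪v, u⟫ = 0 := by rw [real_inner_comm, huv]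
  obtain ⟨c, hc⟩ : ∃ c, c = x + d + ‖d‖ • v := ⟨_, rfl⟩
  have hxc : x - c = -‖d‖ • (u + v) := by
    rw [hc]
    nth_rewrite 1 [hdu]
    module
  have hyc : y - c = ‖d‖ • (u - v) := by
    have : y = x + (2 : ℝ) • d := by rw [hd]; module
    rw [hc, this]
    nth_rewrite 1 2 [hdu]
    module
  have hxc2 : ‖x - c‖ ^ 2 = 2 * ‖d‖ ^ 2 := by
    rw [hxc, norm_smul, mul_pow, norm_add_sq_real, hu, hv, huv, norm_neg, norm_norm]
    ring
  have hxmem : x ∈ Metric.ball c (2 * ‖d‖) := by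
    rw [Metric.mem_ball, dist_eq_norm]
    refine lt_of_pow_lt_pow_left₀ 2 (by positivity) ?_
    rw [hxc2]
    nlinarith
  have hdρ : ‖d‖ < ρ / 4 := by
    rw [hd, norm_smul, ← dist_eq_norm, Real.norm_eq_abs, abs_of_pos (by norm_num)]
    linarith [dist_triangle_right y x p, Metric.mem_ball.1 hx, Metric.mem_ball.1 hy]
  have hball : Metric.ball c (2 * ‖d‖) ⊆ Metric.ball p ρ := by
    refine Metric.ball_subset_ball' ?_
    have h1 : c - p = (1 / 2 : ℝ) • (x - p) + (1 / 2 : ℝ) • (y - p) + ‖d‖ • v := by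
      rw [hc]
      nth_rewrite 1 [hd]
      module
    have h2 : dist c p ≤ ρ / 4 + ‖d‖ := by
      rw [dist_eq_norm, h1]
      refine (norm_add₃_le).trans ?_
      rw [norm_smul, norm_smul, norm_smul, ← dist_eq_norm, ← dist_eq_norm, hv, norm_norm,
        Real.norm_eq_abs, abs_of_pos (by norm_num)]
      linarith [Metric.mem_ball.1 hx, Metric.mem_ball.1 hy]
    linarith
  obtain ⟨κ, hκ⟩ : ∃ κ, κ = (radialBump c (2 * ‖d‖) x)⁻¹ := ⟨_, rfl⟩
  obtain ⟨θ, hθ⟩ : ∃ θ : EuclideanSpace ℝ (Fin n) → ℝ,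
    ∀ z, θ z = κ * radialBump c (2 * ‖d‖) z := ⟨_, fun _ => rfl⟩
  have hθsmooth : ContDiff ℝ ∞ θ := by
    rw [funext hθ]
    exact contDiff_const.mul (contDiff_radialBump _ _)
  have hθout : ∀ z ∉ Metric.ball c (2 * ‖d‖), θ z = 0 := fun z hz => by
    rw [hθ, radialBump_eq_zero (by positivity) hz, mul_zero]
  have hdata : IsSwirlData θ (fun z => θ z • (z - c)) :=
    isSwirlData_of_balls (ι := Unit) (c := fun _ => c) (r := fun _ => 2 * ‖d‖) (ε := fun _ => κ)
      hθsmooth (hθsmooth.smul (contDiff_id.sub contDiff_const)) (fun _ z _ => ⟨hθ z, rfl⟩)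
      fun z hz => by
        rw [hθout z (hz ())]
        exact ⟨rfl, zero_smul _ _⟩
  have hθx : θ x = 1 := by
    rw [hθ, hκ, inv_mul_cancel₀ (radialBump_pos hxmem).ne']
  have hxy' : swirl (planeTurn u v) θ (fun z => θ z • (z - c)) 1 x = y := by
    rw [swirl_eq (c := c) rfl, hθx, ← eq_sub_iff_add_eq', hyc, hxc, planeRotation_apply]
    simp only [planeTurn_apply, map_smul, inner_add_right, inner_sub_right,
      real_inner_smul_right, hu', hv', huv, hvu]
    module
  exact ⟨swirlHomeomorph hJ hdata,
    isEuclIsotopy_swirl hJ hdata fun z hz => hθout z fun h => hz (hball h),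
    measurePreserving_swirl hJ hdata, hxy'⟩

/-- Almost all of `V` is covered by disjoint balls; the swirls in all of these balls together move
all points but those on the axes. -/
theorem euclDense_measurePreserving (hn : 2 ≤ n) :
    EuclDense fun f : EuclideanSpace ℝ (Fin n) ≃ₜ EuclideanSpace ℝ (Fin n) =>
      MeasurePreserving f volume volume := by
  intro V hV _
  obtain ⟨T, r, hTc, hTV, hr, hcover, hdisj⟩ :=
    Besicovitch.exists_disjoint_closedBall_covering_ae volume
      (fun x : EuclideanSpace ℝ (Fin n) => {ρ | Metric.closedBall x ρ ⊆ V}) V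
      (fun x hx δ hδ => by
        obtain ⟨ρ, hρ, hρV⟩ := Metric.nhds_basis_closedBall.mem_iff.1 (hV.mem_nhds hx)
        exact ⟨min ρ (δ / 2), (Metric.closedBall_subset_closedBall (min_le_left _ _)).trans hρV,
          lt_min hρ (by positivity), (min_le_right _ _).trans_lt (by linarith)⟩)
      (fun _ => 1) (fun _ _ => one_pos)
  have : Countable T := hTc.to_subtype
  have hr0 : ∀ i : T, 0 < r i := fun i => (hr i i.2).2.1
  let f : T → EuclideanSpace ℝ (Fin n) → ℝ × EuclideanSpace ℝ (Fin n) := fun i y =>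
    radialBump (i : EuclideanSpace ℝ (Fin n)) (r i) y • ((1 : ℝ), y - i)
  have hfout : ∀ i : T, ∀ y ∉ Metric.ball (i : EuclideanSpace ℝ (Fin n)) (r i), f i y = 0 :=
    fun i y hy => by simp only [f, radialBump_eq_zero (hr0 i) hy, zero_smul]
  obtain ⟨ε, hε, hsmooth⟩ := exists_weights_contDiff_tsum f
    (fun i => (contDiff_radialBump _ _).smul
      (contDiff_const.prodMk (contDiff_id.sub contDiff_const)))
    (fun i => HasCompactSupport.intro (isCompact_closedBall (i : EuclideanSpace ℝ (Fin n)) (r i))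
      fun y hy => hfout i y fun h => hy (Metric.ball_subset_closedBall h))
  let θ : EuclideanSpace ℝ (Fin n) → ℝ := fun y => (∑' i, ε i • f i y).1
  let ξ : EuclideanSpace ℝ (Fin n) → EuclideanSpace ℝ (Fin n) := fun y => (∑' i, ε i • f i y).2
  have hin : ∀ i : T, ∀ y ∈ Metric.ball (i : EuclideanSpace ℝ (Fin n)) (r i),
      θ y = ε i * radialBump (i : EuclideanSpace ℝ (Fin n)) (r i) y ∧
        ξ y = θ y • (y - (i : EuclideanSpace ℝ (Fin n))) := by
    intro i y hy
    have hsum : ∑' j, ε j • f j y = ε i • f i y := by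
      refine tsum_eq_single i fun j hj => ?_
      rw [hfout j y, smul_zero]
      exact fun h => Set.disjoint_left.1 (hdisj j.2 i.2 fun h => hj (Subtype.ext h))
        (Metric.ball_subset_closedBall h) (Metric.ball_subset_closedBall hy)
    have h1 : θ y = ε i * radialBump (i : EuclideanSpace ℝ (Fin n)) (r i) y := by
      show (∑' j, ε j • f j y).1 = _
      rw [hsum]
      simp [f]
    refine ⟨h1, ?_⟩
    rw [h1]
    show (∑' j, ε j • f j y).2 = _
    rw [hsum]
    simp [f, smul_smul]
  have hout : ∀ y, (∀ i : T, y ∉ Metric.ball (i : EuclideanSpace ℝ (Fin n)) (r i)) →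
      θ y = 0 ∧ ξ y = 0 := by
    intro y hy
    have hsum : ∑' j, ε j • f j y = 0 := by
      have : ∀ j, ε j • f j y = 0 := fun j => by rw [hfout j y (hy j), smul_zero]
      simp [this]
    exact ⟨congrArg Prod.fst hsum, congrArg Prod.snd hsum⟩
  have hdata : IsSwirlData θ ξ :=
    isSwirlData_of_balls hsmooth.fst hsmooth.snd hin hout
  let e₀ : EuclideanSpace ℝ (Fin n) := EuclideanSpace.single ⟨0, by omega⟩ 1
  have he₀ : ‖e₀‖ = 1 := by simp [e₀]
  obtain ⟨v, hv, hev⟩ := exists_unit_orthogonal (by simpa using hn) e₀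
  have hJ := isQuarterTurn_planeTurn he₀ hv hev
  refine ⟨_, isEuclIsotopy_swirl hJ hdata fun z hz => ?_, measurePreserving_swirl hJ hdata,
    fun y hy => mem_closure_iff.2 fun Z hZ hyZ => ?_⟩
  · exact (hout z fun i hi => hz ((hr i i.2).1 (Metric.ball_subset_closedBall hi))).1
  · obtain ⟨i, hi⟩ : ∃ i : T,
        (Z ∩ V ∩ Metric.ball (i : EuclideanSpace ℝ (Fin n)) (r i)).Nonempty := by
      by_contra! hno
      have hZV : IsOpen (Z ∩ V) := hZ.inter hV
      suffices Z ∩ V ⊆ V \ ⋃ x ∈ T, Metric.closedBall x (r x) from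
        (hZV.measure_pos volume ⟨y, hyZ, hy⟩).ne' (measure_mono_null this hcover)
      refine fun z hz => ⟨hz.2, fun hzU => ?_⟩
      obtain ⟨x, hx, hzx⟩ := Set.mem_iUnion₂.1 hzU
      rw [← closure_ball x (hr x hx).2.1.ne'] at hzx
      obtain ⟨w, hw, hwx⟩ := mem_closure_iff.1 hzx _ hZV hz
      exact (hno ⟨x, hx⟩).subset ⟨hw, hwx⟩
    have hO : IsOpen (Z ∩ V ∩ Metric.ball (i : EuclideanSpace ℝ (Fin n)) (r i)) :=
      (hZ.inter hV).inter Metric.isOpen_ball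
    obtain ⟨w, hw, hJw⟩ : ∃ w ∈ Z ∩ V ∩ Metric.ball (i : EuclideanSpace ℝ (Fin n)) (r i),
        planeTurn e₀ v (w - i) ≠ 0 := by
      by_contra! hno
      obtain ⟨w, hw⟩ := hi
      obtain ⟨ρ, hρ, hρO⟩ := Metric.isOpen_iff.1 hO w hw
      have h1 := hno w hw
      have h2 := hno (w + (ρ / 2) • e₀) (hρO (by
        rw [Metric.mem_ball, dist_eq_norm, add_sub_cancel_left, norm_smul, he₀, Real.norm_eq_abs,
          abs_of_pos (by positivity)]
        linarith))
      rw [add_sub_right_comm, map_add, h1, zero_add, map_smul, planeTurn_apply,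
        real_inner_self_eq_norm_sq, he₀, real_inner_comm, hev] at h2
      have h3 := congrArg norm h2
      rw [one_pow, one_smul, zero_smul, sub_zero, norm_smul, hv, norm_zero, mul_one,
        norm_eq_zero] at h3
      linarith
    refine ⟨w, hw.1.1, fun hfix => hJw ?_⟩
    have hθw := hin i w hw.2
    have hfix' : swirl (planeTurn e₀ v) θ ξ 1 w = w := hfix
    rw [swirl_eq hθw.2, ← eq_sub_iff_add_eq', one_mul] at hfix'
    refine apply_eq_zero_of_planeRotation_eq hJ ?_ hfix'
    rw [hθw.1]
    exact (mul_pos (hε i) (radialBump_pos hw.2)).ne'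

end SwirlExistence

/-! ### Charts in which a smooth volume is Lebesgue measure -/

section VolumeChart

open Topology

/-- A smooth function with compact support has a smooth antiderivative in every direction: it is
the convolution along this direction with the Heaviside function. -/
theorem exists_contDiff_fderiv_apply_eq {E : Type*} [NormedAddCommGroup E] [NormedSpace ℝ E]
    {σ : E → ℝ} (hσ : ContDiff ℝ ∞ σ) (hsupp : HasCompactSupport σ) {e : E} (he : ‖e‖ = 1) :
    ∃ K : E → ℝ, ContDiff ℝ ∞ K ∧ ∀ y, fderiv ℝ K y e = σ y := by
  obtain ⟨R, hR⟩ := hsupp.isCompact.isBounded.subset_closedBall (0 : E)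
  have hzero : ∀ z, R < ‖z‖ → σ z = 0 := fun z hz => by
    by_contra h
    have := hR (subset_tsupport σ h)
    rw [mem_closedBall_zero_iff] at this
    linarith
  obtain ⟨f, hf⟩ : ∃ f : ℝ → ℝ, f = (Set.Ioi 0).indicator 1 := ⟨_, rfl⟩
  have hfint : LocallyIntegrable f := by
    rw [hf]
    exact (locallyIntegrable_const (1 : ℝ)).indicator measurableSet_Ioi
  obtain ⟨g, hg⟩ : ∃ g : E → ℝ → ℝ, ∀ y u, g y u = σ (y + u • e) := ⟨_, fun _ _ => rfl⟩
  have hgzero : ∀ (c : ℝ) (y : E) (u : ℝ), ‖y‖ < c → u ∉ Set.Icc (-(R + c)) (R + c) →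
      g y u = 0 := by
    intro c y u hy hu
    rw [hg]
    refine hzero _ ?_
    have h1 : R + c < |u| := by
      by_contra! h
      exact hu (abs_le.1 h)
    have h2 : ‖u • e‖ ≤ ‖y + u • e‖ + ‖y‖ := by
      simpa using norm_sub_le (y + u • e) y
    rw [norm_smul, he, mul_one, Real.norm_eq_abs] at h2
    linarith
  have hgsmooth : ContDiff ℝ ∞ ↿g := by
    have : ↿g = fun q : E × ℝ => σ (q.1 + q.2 • e) := funext fun q => hg q.1 q.2
    rw [this]
    exact hσ.comp (contDiff_fst.add (contDiff_snd.smul contDiff_const))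
  obtain ⟨K, hK⟩ : ∃ K : E → ℝ, ∀ y,
    K y = convolution f (g y) (ContinuousLinearMap.mul ℝ ℝ) volume 0 := ⟨_, fun _ => rfl⟩
  have hKsmooth : ContDiff ℝ ∞ K := by
    refine contDiff_iff_contDiffAt.2 fun y => ?_
    have := contDiffOn_convolution_right_with_param_comp (n := ⊤) (μ := volume)
      (ContinuousLinearMap.mul ℝ ℝ) (v := fun _ : E => (0 : ℝ)) (f := f) (g := g)
      contDiffOn_const (Metric.isOpen_ball (x := (0 : E)) (ε := ‖y‖ + 1))
      (isCompact_Icc (a := -(R + (‖y‖ + 1))) (b := R + (‖y‖ + 1)))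
      (fun p u hp hu => hgzero _ p u (mem_ball_zero_iff.1 hp) hu) hfint hgsmooth.contDiffOn
    rw [funext hK]
    exact this.contDiffAt (Metric.isOpen_ball.mem_nhds (by simp))
  refine ⟨K, hKsmooth, fun y => ?_⟩
  have hgy : ContDiff ℝ 1 (g y) := by
    rw [funext (hg y)]
    exact (hσ.comp (contDiff_const.add (contDiff_id.smul contDiff_const))).of_le (by simp)
  have hgys : HasCompactSupport (g y) :=
    HasCompactSupport.intro (isCompact_Icc (a := -(R + (‖y‖ + 1))) (b := R + (‖y‖ + 1)))
      fun u hu => hgzero _ y u (by linarith) hu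
  have h1 := hgys.hasDerivAt_convolution_right (ContinuousLinearMap.mul ℝ ℝ) hfint hgy 0
  have h2 : HasDerivAt (fun s : ℝ => K (y + s • e)) (fderiv ℝ K y e) 0 := by
    have := (hKsmooth.differentiable (by simp) (y + (0 : ℝ) • e)).hasFDerivAt.comp_hasDerivAt
      (0 : ℝ) (((hasDerivAt_id (0 : ℝ)).smul_const e).const_add y)
    simpa [Function.comp_def] using this
  have h3 : (fun s : ℝ => K (y + s • e)) =
      convolution f (g y) (ContinuousLinearMap.mul ℝ ℝ) volume := by
    funext s
    rw [hK]
    refine integral_congr_ae (Filter.Eventually.of_forall fun t => ?_)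
    simp only [hg]
    congr 2
    module
  rw [h3] at h2
  rw [h2.unique h1]
  calc convolution f (deriv (g y)) (ContinuousLinearMap.mul ℝ ℝ) volume 0
      = ∫ t in Set.Ioi 0, deriv (g y) (-t) := by
        rw [← integral_indicator measurableSet_Ioi]
        refine integral_congr_ae (Filter.Eventually.of_forall fun t => ?_)
        by_cases ht : t ∈ Set.Ioi (0 : ℝ) <;> simp [hf, ht]
    _ = ∫ t in Set.Iic 0, deriv (g y) t := by
        rw [integral_comp_neg_Ioi, neg_zero]
    _ = σ y := by
        rw [hgys.integral_Iic_deriv_eq hgy, hg, zero_smul, add_zero]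

variable {n : ℕ}

/-- A smooth positive density can be removed by a change of one coordinate: replace this
coordinate by an antiderivative of the density along it. -/
theorem exists_openPartialHomeomorph_of_density (hn : 0 < n)
    {T : Set (EuclideanSpace ℝ (Fin n))} (hT : IsOpen T) {ρ : EuclideanSpace ℝ (Fin n) → ℝ}
    (hρ : ContDiffOn ℝ ∞ ρ T) (hpos : ∀ z ∈ T, 0 < ρ z) {y : EuclideanSpace ℝ (Fin n)}
    (hy : y ∈ T) :
    ∃ φ : OpenPartialHomeomorph (EuclideanSpace ℝ (Fin n)) (EuclideanSpace ℝ (Fin n)),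
      y ∈ φ.source ∧ φ.source ⊆ T ∧ ContDiffOn ℝ ∞ φ φ.source ∧ ContDiffOn ℝ ∞ φ.symm φ.target ∧
      ∀ A, MeasurableSet A → A ⊆ φ.source →
        volume (φ '' A) = ∫⁻ z in A, ENNReal.ofReal (ρ z) := by
  obtain ⟨r, hr, hrT⟩ := Metric.nhds_basis_closedBall.mem_iff.1 (hT.mem_nhds hy)
  let χ : ContDiffBump y := ⟨r / 2, r, by positivity, by linarith⟩
  obtain ⟨σ, hσ⟩ : ∃ σ : EuclideanSpace ℝ (Fin n) → ℝ, ∀ z, σ z = χ z * ρ z := ⟨_, fun _ => rfl⟩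
  have hσout : ∀ z ∉ Metric.closedBall y r, σ z = 0 := fun z hz => by
    rw [hσ, χ.zero_of_le_dist (le_of_lt (by simpa using hz)), zero_mul]
  have hσsmooth : ContDiff ℝ ∞ σ := by
    refine contDiff_iff_contDiffAt.2 fun z => ?_
    by_cases hz : z ∈ T
    · rw [funext hσ]
      exact χ.contDiffAt.mul (hρ.contDiffAt (hT.mem_nhds hz))
    · have : σ =ᶠ[𝓝 z] fun _ => 0 := by
        filter_upwards [Metric.isClosed_closedBall.isOpen_compl.mem_nhds fun h => hz (hrT h)]
          with w hw using hσout w hw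
      exact contDiffAt_const.congr_of_eventuallyEq this
  obtain ⟨e, he⟩ : ∃ e : EuclideanSpace ℝ (Fin n), ‖e‖ = 1 :=
    ⟨EuclideanSpace.single ⟨0, hn⟩ 1, by simp⟩
  obtain ⟨K, hK, hKe⟩ := exists_contDiff_fderiv_apply_eq hσsmooth
    (HasCompactSupport.intro (isCompact_closedBall y r) hσout) he
  -- `Φ` replaces the coordinate `⟪e, z⟫` of `z` by `K z`
  obtain ⟨Φ, hΦ⟩ : ∃ Φ : EuclideanSpace ℝ (Fin n) → EuclideanSpace ℝ (Fin n),
    Φ = fun z => z + (K z - innerSL ℝ e z) • e := ⟨_, rfl⟩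
  have hΦsmooth : ContDiff ℝ ∞ Φ := by
    rw [hΦ]
    exact contDiff_id.add ((hK.sub (innerSL ℝ e).contDiff).smul contDiff_const)
  have hderiv : ∀ z, HasFDerivAt Φ (ContinuousLinearMap.id ℝ (EuclideanSpace ℝ (Fin n)) +
      (fderiv ℝ K z - innerSL ℝ e).smulRight e) z := fun z => by
    rw [hΦ]
    exact (hasFDerivAt_id z).add
      (((hK.differentiable (by simp) z).hasFDerivAt.sub (innerSL ℝ e).hasFDerivAt).smul_const e)
  have hball : Metric.ball y (r / 2) ⊆ T := (Metric.ball_subset_ball (by linarith)).trans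
    (Metric.ball_subset_closedBall.trans hrT)
  have hdet : ∀ z ∈ Metric.ball y (r / 2),
      (ContinuousLinearMap.id ℝ (EuclideanSpace ℝ (Fin n)) +
        (fderiv ℝ K z - innerSL ℝ e).smulRight e).det = ρ z := fun z hz => by
    rw [det_id_add_smulRight, sub_apply, hKe, hσ,
      χ.one_of_mem_closedBall (Metric.ball_subset_closedBall hz), innerSL_apply_apply,
      real_inner_self_eq_norm_sq, he]
    ring
  have hequiv : ∀ z ∈ Metric.ball y (r / 2),
      ∃ L : EuclideanSpace ℝ (Fin n) ≃L[ℝ] EuclideanSpace ℝ (Fin n),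
        HasFDerivAt Φ (L : EuclideanSpace ℝ (Fin n) →L[ℝ] EuclideanSpace ℝ (Fin n)) z :=
    fun z hz => ⟨ContinuousLinearMap.toContinuousLinearEquivOfDetNeZero _
      ((hdet z hz).trans_ne (hpos z (hball hz)).ne'), by
        rw [ContinuousLinearMap.coe_toContinuousLinearEquivOfDetNeZero]
        exact hderiv z⟩
  have hymem : y ∈ Metric.ball y (r / 2) := Metric.mem_ball_self (by positivity)
  obtain ⟨L, hL⟩ := hequiv y hymem
  obtain ⟨ψ, hψ, hyψ⟩ : ∃ ψ : OpenPartialHomeomorph (EuclideanSpace ℝ (Fin n))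
      (EuclideanSpace ℝ (Fin n)), ⇑ψ = Φ ∧ y ∈ ψ.source :=
    ⟨hΦsmooth.contDiffAt.toOpenPartialHomeomorph Φ hL (by simp), rfl,
      hΦsmooth.contDiffAt.mem_toOpenPartialHomeomorph_source hL (by simp)⟩
  have hsource : (ψ.restrOpen _ (Metric.isOpen_ball (x := y) (ε := r / 2))).source =
      ψ.source ∩ Metric.ball y (r / 2) := ψ.restrOpen_source _ _
  have hcoe : ⇑(ψ.restrOpen _ (Metric.isOpen_ball (x := y) (ε := r / 2))) = Φ := hψ
  generalize ψ.restrOpen _ (Metric.isOpen_ball (x := y) (ε := r / 2)) = φ at hsource hcoe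
  have hφball : φ.source ⊆ Metric.ball y (r / 2) := hsource ▸ Set.inter_subset_right
  refine ⟨φ, hsource ▸ ⟨hyψ, hymem⟩, hφball.trans hball, hcoe ▸ hΦsmooth.contDiffOn,
    fun w hw => ?_, fun A hA hAφ => ?_⟩
  · obtain ⟨L', hL'⟩ := hequiv _ (hφball (φ.map_target hw))
    exact (φ.contDiffAt_symm hw (hcoe ▸ hL') (hcoe ▸ hΦsmooth.contDiffAt)).contDiffWithinAt
  · rw [hcoe, ← lintegral_abs_det_fderiv_eq_addHaar_image volume hA
      (fun z _ => (hderiv z).hasFDerivWithinAt) (hcoe ▸ φ.injOn.mono hAφ)]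
    refine setLIntegral_congr_fun hA fun z hz => ?_
    have hz' := hφball (hAφ hz)
    simp only [hdet z hz', abs_of_pos (hpos z (hball hz'))]

variable {M : Type*} [TopologicalSpace M] [ChartedSpace (EuclideanSpace ℝ (Fin n)) M]
  [IsManifold (𝓡 n) ∞ M]

theorem isSmoothChart_chartAt (p : M) :
    IsSmoothChart (chartAt (EuclideanSpace ℝ (Fin n)) p) :=
  ⟨contMDiffOn_chart, contMDiffOn_chart_symm⟩

theorem _root_.OpenPartialHomeomorph.measurableSet_image {X Y : Type*} [TopologicalSpace X]
    [TopologicalSpace Y] [MeasurableSpace X] [MeasurableSpace Y] [BorelSpace X] [BorelSpace Y]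
    (e : OpenPartialHomeomorph X Y) {A : Set X} (hA : MeasurableSet A) (hAe : A ⊆ e.source) :
    MeasurableSet (e '' A) := by
  rw [e.image_eq_target_inter_inv_preimage hAe, ← Subtype.image_preimage_coe]
  exact e.open_target.measurableSet.subtype_image
    ((continuousOn_iff_continuous_domRestrict.1 e.continuousOn_symm).measurable hA)

/-- Every point lies in the domain of a smooth chart that carries the volume to Lebesgue measure. -/
theorem IsSmoothVolume.exists_isVolumeChart [MeasurableSpace M] [BorelSpace M] {μ : Measure M}
    (hμ : IsSmoothVolume n μ) (hn : 0 < n) (p : M) :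
    ∃ e : OpenPartialHomeomorph M (EuclideanSpace ℝ (Fin n)),
      p ∈ e.source ∧ IsSmoothChart e ∧ IsVolumeChart μ e := by
  obtain ⟨ρ, hρ, hpos, hμρ⟩ := hμ p
  have hp := mem_chart_source (EuclideanSpace ℝ (Fin n)) p
  obtain ⟨h1, h2⟩ := isSmoothChart_chartAt (n := n) p
  generalize chartAt (EuclideanSpace ℝ (Fin n)) p = c at hp h1 h2 hρ hpos hμρ
  obtain ⟨φ, hpφ, -, h3, h4, hvol⟩ :=
    exists_openPartialHomeomorph_of_density hn c.open_target hρ hpos (c.map_source hp)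
  refine ⟨c ≫ₕ φ, ⟨hp, hpφ⟩, ⟨?_, ?_⟩, fun A hA hAe => ?_⟩
  · exact h3.contMDiffOn.comp' h1
  · exact h2.comp' h4.contMDiffOn
  · rw [OpenPartialHomeomorph.trans_source] at hAe
    rw [hμρ A hA (hAe.trans Set.inter_subset_left), ← hvol _
      (c.measurableSet_image hA (hAe.trans Set.inter_subset_left)), Set.image_image]
    · rfl
    · rintro _ ⟨x, hx, rfl⟩
      exact (hAe hx).2

end VolumeChart

/-! ### Diffeomorphism groups of closed manifolds -/

section Closed

variable {n : ℕ} {M : Type*} [TopologicalSpace M] [T2Space M]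
  [ChartedSpace (EuclideanSpace ℝ (Fin n)) M] [IsManifold (𝓡 n) ∞ M] {G : Subgroup (M ≃ₜ M)}

theorem containsChartIsotopies_of_diffZero_subset (hG : diffZero n M ⊆ G) :
    ContainsChartIsotopies (n := n) (fun _ => True) G := by
  intro p
  refine ⟨chartAt _ p, mem_chart_source _ p, fun F V K hF _ hVK hK hKe => ?_⟩
  obtain ⟨F', hF', hFF'⟩ := hF.exists_isSmoothIsotopy (isSmoothChart_chartAt p) hVK hK hKe
  exact ⟨⟨F' 1, hG ⟨F', hF', rfl⟩⟩, hFF' 1⟩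

theorem containsChartIsotopies_of_diffZeroVol_subset [MeasurableSpace M] [BorelSpace M]
    {μ : Measure M} (hμ : IsSmoothVolume n μ) (hn : 0 < n) (hG : diffZeroVol n μ ⊆ G) :
    ContainsChartIsotopies (n := n) (fun f => MeasurePreserving f volume volume) G := by
  intro p
  obtain ⟨e, hpe, he, hμe⟩ := hμ.exists_isVolumeChart hn p
  refine ⟨e, hpe, fun F V K hF hvol hVK hK hKe => ?_⟩
  obtain ⟨F', hF', hFF'⟩ := hF.exists_isSmoothIsotopy he hVK hK hKe
  have hfix : ∀ t, ∀ y ∉ K, F t y = y := fun t y hy => hF.fixed t y fun h => hy (hVK h)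
  exact ⟨⟨F' 1, hG ⟨F', hF', fun t => hμe.measurePreserving (hvol t)
    (mapsTo_of_fixed_off (F t).injective (hfix t) hKe)
    (mapsTo_of_fixed_off (F t).symm.injective (symm_fixed_off (F t).toEquiv (hfix t)) hKe)
    (hFF' t), rfl⟩⟩, hFF' 1⟩

theorem IsAdmissible.locallyDense_and_locallyMixing [MeasurableSpace M] [BorelSpace M]
    (hG : IsAdmissible n G) (hn : 0 < n) : LocallyDense G M ∧ LocallyMixing G M := by
  rcases hG with hG | ⟨hn2, μ, hμ, hG, -⟩
  · have h := containsChartIsotopies_of_diffZero_subset hG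
    exact ⟨h.locallyDense (euclDense_true hn), h.locallyMixing euclMixing_true⟩
  · have h := containsChartIsotopies_of_diffZeroVol_subset hμ hn hG
    exact ⟨h.locallyDense (euclDense_measurePreserving hn2),
      h.locallyMixing (euclMixing_measurePreserving hn2)⟩

end Closed

end DiffGroups

theorem mainTheorem8 :
    ∃ infcomp : DiffGroups.groupLang.Formula (Fin 1),
      ∀ (n : ℕ) (M : Type*) [TopologicalSpace M] [T2Space M] [CompactSpace M] [ConnectedSpace M]
        [ChartedSpace (EuclideanSpace ℝ (Fin n)) M] [IsManifold (𝓡 n) ∞ M]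
        [MeasurableSpace M] [BorelSpace M] (G : Subgroup (M ≃ₜ M)),
        0 < n → DiffGroups.IsAdmissible n G →
        ∀ W : Set M, DiffGroups.IsRegularOpen W →
          (∃ g : G, DiffGroups.extSupport (g : M ≃ₜ M) = W) ∧
          ∀ g : G, DiffGroups.extSupport (g : M ≃ₜ M) = W →
            (infcomp.Realize (fun _ => g) ↔ Infinite (ConnectedComponents W)) := by
  refine ⟨DiffGroups.infCompF (FirstOrder.Language.Term.var 0), fun n M => ?_⟩
  intro _ _ _ _ _ _ _ _ G hn hG W hW
  obtain ⟨hdense, hmix⟩ := hG.locallyDense_and_locallyMixing hn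
  have hreal := hdense.realizesRegularOpen
  have : LocallyConnectedSpace M :=
    ChartedSpace.locallyConnectedSpace (EuclideanSpace ℝ (Fin n)) M
  refine ⟨hreal W hW, fun g hg => ?_⟩
  have hg' : DiffGroups.extSupp M g = W := hg
  rw [DiffGroups.realize_infCompF, DiffGroups.infinite_connectedComponents_iff,
    DiffGroups.infComp_iff hreal.locallyMoving hreal hmix]
  simp only [FirstOrder.Language.Term.realize_var, hg']
  exact ⟨fun ⟨_, _, _, _, _, _, h⟩ => h.infinite,
    DiffGroups.exists_hasMatchings n (hW ▸ isOpen_interior)⟩
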